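/- \textbf{Theorem (Moderate deviations).} Let $L\ge 1$, $n_0\ge 1$, $n_{L+1}\ge 1$, let $\sigma:\mathbb R\to\mathbb R$ be continuous and bounded, let $C_b\ge 0$, $C_W>0$, and let $(x_\alpha)_{\alpha\in A}$ be a finite family of points of $\mathbb R^{n_0}$, $x_\alpha=(x_{\alpha,1},\dots,x_{\alpha,n_0})$. For every $n$ let $n_1(n),\dots,n_L(n)$ be positive integers, each tending to infinity as $n\to\infty$ (and set $n_0(n)=n_0$, $n_{L+1}(n)=n_{L+1}$). Assume that there are $\widehat\ell\in\{1,\dots,L\}$ and $\gamma_1,\dots,\gamma_L\in[1,\infty]$ with $n_\ell(n)/n_{\widehat\ell}(n)\to\gamma_\ell$ for all $\ell=1,\dots,L$, and put $v_n^*=n_{\widehat\ell}(n)$. For every $n$ let $$Z_i^{(1)}(x)=b_i^{(1)}+\sum_{r=1}^{n_0}W_{ir}^{(1)}x_r,\qquad Z_i^{(\ell+1)}(x)=b_i^{(\ell+1)}+\sum_{j=1}^{n_\ell(n)}W_{ij}^{(\ell+1)}\sigma(Z_j^{(\ell)}(x))\quad(1\le\ell\le L,\ 1\le i\le n_{\ell+1}(n)),$$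 where, for $0\le \ell\le L$, the biases $b_i^{(\ell+1)}$ are centered normal with variance $C_b$, the weights $W_{ij}^{(\ell+1)}$ are centered normal with variance $C_W/n_\ell(n)$, and, for each $n$, all these random variables are independent. For a symmetric positive semidefinite matrix $q=(q_{\alpha\beta})_{\alpha,\beta\in A}$ let $q^\#$ be its symmetric positive semidefinite square root and let $$y_{\alpha\beta}(q)=\mathbb E\Big[\sigma\Big(\sum_{\gamma\in A} q^\#_{\alpha\gamma}N_\gamma\Big)\,\sigma\Big(\sum_{\gamma\in A} q^\#_{\beta\gamma}N_\gamma\Big)\Big],$$ with $(N_\gamma)_{\gamma\in A}$ independent standard normal. Define $\widehat g^{(0)},\dots,\widehat g^{(L)}$ by $$\widehat g^{(0)}_{\alpha\beta}=C_b+\frac{C_W}{n_0}\sum_{r=1}^{n_0}x_{\alpha,r}x_{\beta,r},\qquad \widehat g^{(\ell)}_{\alpha\beta}=C_b+C_W\,y_{\alpha\beta}(\widehat g^{(\ell-1)})\quad(1\le\ell\le L).$$ Then, for every sequence of positive numbers $(a_n)$ with $a_n\to0$ and $a_nv_n^*\to\infty$, the sequence of random matrices $\big(\sqrt{a_n}\,Z_h^{(L+1)}(x_\alpha)\big)_{\alpha\in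 A,\,1\le h\le n_{L+1}}$ satisfies the large deviation principle on $\mathbb R^{|A|\times n_{L+1}}$ with speed $1/a_n$ and good rate function $$\widetilde I(z)=\inf\big\{\|r\|^2/2:\ r\in\mathbb R^{|A|\times n_{L+1}},\ \widehat g^{(L),\#}r=z\big\}\qquad(\inf\emptyset=\infty),$$ where $\|\cdot\|$ is the Euclidean norm. That is, with $\pi_n$ the law of the $n$-th random matrix, $\widetilde I$ is lower semicontinuous with compact level sets $\{\widetilde I\le\lambda\}$, $0\le\lambda<\infty$, and $$\limsup_{n\to\infty}a_n\log\pi_n(C)\le-\inf_{z\in C}\widetilde I(z)\ \text{ for every closed }C,\qquad \liminf_{n\to\infty}a_n\log\pi_n(O)\ge-\inf_{z\in O}\widetilde I(z)\ \text{ for every open }O.$$ If moreover $\widehat g^{(L)}$ is invertible, then $\widehat g^{(L),\#}$ is invertible and $\widetilde I(z)=\|(\widehat g^{(L),\#})^{-1}z\|^2/2$ for all $z\in\mathbb R^{|A|\times n_{L+1}}$. -/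

import Mathlib

open MeasureTheory ProbabilityTheory Filter Topology
open scoped ENNReal NNReal MatrixOrder

/-! ### Large deviation principles -/

/-- A speed function: positive numbers tending to infinity. -/
def IsSpeed (v : ℕ → ℝ) : Prop :=
  (∀ n, 0 < v n) ∧ Tendsto v atTop atTop

/-- A good rate function: lower semicontinuous, with compact level sets. -/
def IsGoodRateFunction {X : Type*} [TopologicalSpace X] (I : X → ℝ≥0∞) : Prop :=
  LowerSemicontinuous I ∧ ∀ c : ℝ≥0, IsCompact {x | I x ≤ c}

/-- The sequence `π` of measures satisfies the large deviation principle with speed `v` and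
rate function `I`. Logarithms, limits and bounds are taken in the extended reals. -/
structure SatisfiesLDP {X : Type*} [TopologicalSpace X] [MeasurableSpace X]
    (π : ℕ → Measure X) (v : ℕ → ℝ) (I : X → ℝ≥0∞) : Prop where
  prob : ∀ n, IsProbabilityMeasure (π n)
  speed : IsSpeed v
  lsc : LowerSemicontinuous I
  upper : ∀ C : Set X, IsClosed C →
    limsup (fun n => ((1 / v n : ℝ) : EReal) * ENNReal.log (π n C)) atTop
      ≤ -((⨅ x ∈ C, I x : ℝ≥0∞) : EReal)
  lower : ∀ O : Set X, IsOpen O →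
    -((⨅ x ∈ O, I x : ℝ≥0∞) : EReal)
      ≤ liminf (fun n => ((1 / v n : ℝ) : EReal) * ENNReal.log (π n O)) atTop

/-! ### Gaussian fully connected neural networks -/

/-- `preactivation σ w b W x ℓ i` is `Z_i^{(ℓ+1)}(x)`, for the network with widths `w ℓ = n_ℓ`,
biases `b ℓ i = b_i^{(ℓ)}` and weights `W ℓ i j = W_{ij}^{(ℓ)}` (`ℓ ≥ 1`).
Neurons of layer `ℓ` are numbered `0, …, n_ℓ - 1`. -/
def preactivation (σ : ℝ → ℝ) {n₀ : ℕ} (w : ℕ → ℕ) (b : ℕ → ℕ → ℝ) (W : ℕ → ℕ → ℕ → ℝ)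
    (x : Fin n₀ → ℝ) : ℕ → ℕ → ℝ
  | 0, i => b 1 i + ∑ r : Fin n₀, W 1 i r * x r
  | ℓ + 1, i => b (ℓ + 2) i +
      ∑ j ∈ Finset.range (w (ℓ + 1)), W (ℓ + 2) i j * σ (preactivation σ w b W x ℓ j)

/-- Indices of the parameters of a network with `L` hidden layers and widths `w`: the biases
`(ℓ, i)` and the weights `(ℓ, (i, j))`; here `ℓ ∈ {0, …, L}` stands for the layer `ℓ + 1`. -/
def ParamIndex (L : ℕ) (w : ℕ → ℕ) : Type :=
  (Σ ℓ : Fin (L + 1), Fin (w (ℓ + 1))) ⊕ (Σ ℓ : Fin (L + 1), Fin (w (ℓ + 1)) × Fin (w ℓ))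

/-- All the parameters of the network, as one family. -/
def networkParam {Ω : Type*} (L : ℕ) (w : ℕ → ℕ) (b : ℕ → ℕ → Ω → ℝ)
    (W : ℕ → ℕ → ℕ → Ω → ℝ) : ParamIndex L w → Ω → ℝ :=
  Sum.elim (fun k => b (k.1 + 1) k.2) (fun k => W (k.1 + 1) k.2.1 k.2.2)

/-- The biases are `N(0, C_b)`, the weights of layer `ℓ + 1` are `N(0, C_W / n_ℓ)`, and all these
random variables are independent. Only the parameters that occur in the network are concerned. -/
structure IsGaussianInit {Ω : Type*} [MeasurableSpace Ω] (P : Measure Ω) (L : ℕ) (w : ℕ → ℕ)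
    (Cb CW : ℝ≥0) (b : ℕ → ℕ → Ω → ℝ) (W : ℕ → ℕ → ℕ → Ω → ℝ) : Prop where
  bias : ∀ ℓ ≤ L, ∀ i < w (ℓ + 1), HasLaw (b (ℓ + 1) i) (gaussianReal 0 Cb) P
  weight : ∀ ℓ ≤ L, ∀ i < w (ℓ + 1), ∀ j < w ℓ,
    HasLaw (W (ℓ + 1) i j) (gaussianReal 0 (CW / (w ℓ : ℝ≥0))) P
  indep : iIndepFun (networkParam L w b W) P

/-- The random matrix `(Z_h^{(L+1)}(x_α))_{α h}`. -/
def networkOutput {Ω A : Type*} (σ : ℝ → ℝ) (L : ℕ) {n₀ : ℕ} (m : ℕ) (w : ℕ → ℕ)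
    (b : ℕ → ℕ → Ω → ℝ) (W : ℕ → ℕ → ℕ → Ω → ℝ) (x : A → Fin n₀ → ℝ) (ω : Ω) :
    A → Fin m → ℝ :=
  fun α h => preactivation σ w (fun ℓ i => b ℓ i ω) (fun ℓ i j => W ℓ i j ω) (x α) L h

/-- The condition on the hidden widths `w n ℓ = n_ℓ(n)`, `1 ≤ ℓ ≤ L`: they are positive and
diverge, and `n_ℓ(n) / n_{ℓ'}(n) → γ_ℓ ∈ [1, ∞]`, for the hidden layer `ℓ'`. -/
structure WidthCondition (L : ℕ) (w : ℕ → ℕ → ℕ) (ℓ' : ℕ) (γ : ℕ → ℝ≥0∞) : Prop where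
  pos : ∀ n, ∀ ℓ ∈ Finset.Icc 1 L, 0 < w n ℓ
  diverge : ∀ ℓ ∈ Finset.Icc 1 L, Tendsto (fun n => w n ℓ) atTop atTop
  mem : ℓ' ∈ Finset.Icc 1 L
  one_le : ∀ ℓ ∈ Finset.Icc 1 L, 1 ≤ γ ℓ
  ratio : ∀ ℓ ∈ Finset.Icc 1 L,
    Tendsto (fun n => (w n ℓ : ℝ≥0∞) / (w n ℓ' : ℝ≥0∞)) atTop (𝓝 (γ ℓ))

/-! ### The limiting covariance and the rate function -/

section Covariance

variable {A : Type*} [Fintype A] [DecidableEq A]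

/-- The symmetric positive semidefinite square root `q^#` of a symmetric positive semidefinite
matrix `q`. -/
noncomputable def matSqrt (q : Matrix A A ℝ) : Matrix A A ℝ := CFC.sqrt q

/-- `matSqrt q` is the unique positive semidefinite matrix whose square is `q`. -/
theorem matSqrt_eq_iff {q s : Matrix A A ℝ} (hq : q.PosSemidef) :
    matSqrt q = s ↔ s.PosSemidef ∧ s * s = q := by
  constructor
  · rintro rfl
    exact ⟨Matrix.nonneg_iff_posSemidef.1 (CFC.sqrt_nonneg q),
      CFC.sqrt_mul_sqrt_self q hq.nonneg⟩
  · rintro ⟨hs, rfl⟩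
    exact CFC.sqrt_mul_self s hs.nonneg

/-- `y_{αβ}(q) = E[σ(⟨q^#_{α·}, N⟩) σ(⟨q^#_{β·}, N⟩)]` with `N` a vector of independent standard
normal random variables. -/
noncomputable def yMat (σ : ℝ → ℝ) (q : Matrix A A ℝ) : Matrix A A ℝ :=
  Matrix.of fun α β =>
    ∫ N : A → ℝ, σ (∑ γ, matSqrt q α γ * N γ) * σ (∑ γ, matSqrt q β γ * N γ)
      ∂(Measure.pi fun _ : A => gaussianReal 0 1)

/-- The limiting covariance recursion `ĝ^{(ℓ)}`. -/
noncomputable def limitCov (σ : ℝ → ℝ) (Cb CW : ℝ≥0) {n₀ : ℕ} (x : A → Fin n₀ → ℝ) :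
    ℕ → Matrix A A ℝ
  | 0 => Matrix.of fun α β => (Cb : ℝ) + (CW : ℝ) / (n₀ : ℝ) * ∑ r, x α r * x β r
  | ℓ + 1 => Matrix.of fun α β => (Cb : ℝ) + (CW : ℝ) * yMat σ (limitCov σ Cb CW x ℓ) α β

/-- The squared Euclidean norm on `ℝ^{|A| × m}`. -/
def normSq {m : ℕ} (r : Matrix A (Fin m) ℝ) : ℝ := ∑ α, ∑ h, r α h ^ 2

/-- `z ↦ inf {‖r‖² / 2 : g^# r = z}`, with value `∞` if there is no such `r`. -/
noncomputable def mdRate {m : ℕ} (g : Matrix A A ℝ) (z : A → Fin m → ℝ) : ℝ≥0∞ :=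
  ⨅ (r : Matrix A (Fin m) ℝ) (_ : matSqrt g * r = Matrix.of z), ENNReal.ofReal (normSq r / 2)

end Covariance

/-!
Given the hidden layers, the columns of the output matrix are independent centered Gaussian vectors
whose common covariance matrix is the random matrix `empCov`, an average over the neurons of the
last hidden layer (`lintegral_empCov_mul_prod`).

Since `σ` is bounded, Hoeffding's lemma shows that `empCov` of layer `ℓ + 1` concentrates around
`C_b + C_W y(q)`, where `q` is `empCov` of layer `ℓ`, with a probability of deviation that is
exponentially small in the width `n_{ℓ+1}`. As `q ↦ y(q)` is continuous on positive semidefinite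
matrices (`continuousOn_yMat`), induction on the layers gives concentration around `limitCov`. All
widths are at least of the order of `n_{ℓ'}`, and `a_n n_{ℓ'} → ∞`, so that the probability of a
deviation is negligible on the exponential scale with speed `1 / a_n`
(`measure_not_isNear_limitCov_le`).

Therefore the Laplace transform of the rescaled output,
`E exp (⟨θ, √a_n Z⟩ / a_n) = E exp (½ ∑ₕ ⟨θₕ, empCov θₕ⟩ / a_n)`, behaves like
`exp (½ ∑ₕ ⟨θₕ, limitCov θₕ⟩ / a_n)` (`hasLaplaceLimit_networkOutput`); here the boundedness of
`empCov` takes care of the exceptional event.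

The large deviation principle follows as in the Gärtner–Ellis theorem
(`satisfiesLDP_of_hasLaplaceLimit`). For the upper bound, a closed set is covered by finitely many
half-spaces. For the lower bound, a point with finite rate has the form `g θ₀` with `g = limitCov`;
it is the gradient at `θ₀` of the quadratic limit, and the law tilted by `θ₀` concentrates at it.
This needs no invertibility of `g`. The Legendre transform of the quadratic form is the rate
function, by the decomposition of the space into the range and the kernel of `g^#`.
-/

/-! ### The rate function and its Legendre dual -/

section Rate

variable {A : Type*} [Fintype A] {m : ℕ}

/-- The Euclidean inner product on `ℝ^{|A| × m}`. -/
def pairing (θ z : A → Fin m → ℝ) : ℝ := ∑ α, ∑ h, θ α h * z α h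

/-- The logarithmic Laplace transform `θ ↦ ½ ∑ₕ ⟨θₕ, g θₕ⟩` of a matrix whose `m` columns are
independent `N(0, g)` vectors. -/
noncomputable def logLaplace (g : Matrix A A ℝ) (θ : A → Fin m → ℝ) : ℝ :=
  (∑ α, ∑ β, g α β * ∑ h, θ α h * θ β h) / 2

theorem pairing_eq_trace (θ z : Matrix A (Fin m) ℝ) : pairing θ z = (θ.transpose * z).trace := by
  simp only [pairing, Matrix.trace, Matrix.diag, Matrix.mul_apply, Matrix.transpose_apply]
  exact Finset.sum_comm

theorem pairing_self (z : Matrix A (Fin m) ℝ) : pairing z z = normSq z := by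
  simp [pairing, normSq, sq]

theorem logLaplace_eq_pairing (g : Matrix A A ℝ) (θ : Matrix A (Fin m) ℝ) :
    logLaplace g θ = pairing θ (g * θ) / 2 := by
  simp only [pairing, logLaplace, Matrix.mul_apply, Finset.mul_sum]
  congr 1
  refine Finset.sum_congr rfl fun α _ => ?_
  rw [Finset.sum_comm]
  exact Finset.sum_congr rfl fun _ _ => Finset.sum_congr rfl fun _ _ => by ring

theorem pairing_mul_of_transpose_eq {s : Matrix A A ℝ} (hs : s.transpose = s)
    (θ z : Matrix A (Fin m) ℝ) : pairing θ (s * z) = pairing (s * θ) z := by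
  rw [pairing_eq_trace, pairing_eq_trace, Matrix.transpose_mul, hs, Matrix.mul_assoc]

theorem normSq_nonneg (r : Matrix A (Fin m) ℝ) : 0 ≤ normSq r :=
  Finset.sum_nonneg fun _ _ => Finset.sum_nonneg fun _ _ => sq_nonneg _

theorem eq_zero_of_normSq_eq_zero {r : Matrix A (Fin m) ℝ} (h : normSq r = 0) : r = 0 := by
  ext α k
  have h1 := (Finset.sum_eq_zero_iff_of_nonneg
    (fun α _ => Finset.sum_nonneg fun k _ => sq_nonneg (r α k))).1 h α (Finset.mem_univ _)
  have h2 := (Finset.sum_eq_zero_iff_of_nonneg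
    (fun k _ => sq_nonneg (r α k))).1 h1 k (Finset.mem_univ _)
  simpa using h2

theorem pairing_le_half_add_half (θ r : A → Fin m → ℝ) :
    pairing θ r ≤ normSq (A := A) θ / 2 + normSq (A := A) r / 2 := by
  rw [← add_div]
  simp only [pairing, normSq, ← Finset.sum_add_distrib, Finset.sum_div]
  gcongr with α _ h _
  nlinarith [sq_nonneg (θ α h - r α h)]

theorem pairing_smul_left (t : ℝ) (θ z : A → Fin m → ℝ) :
    pairing (t • θ) z = t * pairing θ z := by
  simp [pairing, Finset.mul_sum, mul_assoc]

theorem pairing_add_left (θ θ' z : A → Fin m → ℝ) :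
    pairing (θ + θ') z = pairing θ z + pairing θ' z := by
  simp [pairing, Finset.sum_add_distrib, add_mul]

theorem pairing_add_right (θ z z' : A → Fin m → ℝ) :
    pairing θ (z + z') = pairing θ z + pairing θ z' := by
  simp [pairing, Finset.sum_add_distrib, mul_add]

@[fun_prop]
theorem continuous_pairing (θ : A → Fin m → ℝ) : Continuous (pairing θ) := by
  unfold pairing; fun_prop

theorem abs_pairing_sub_le (θ y z : A → Fin m → ℝ) :
    |pairing θ y - pairing θ z| ≤ (∑ α, ∑ h, |θ α h|) * dist y z := by
  have : pairing θ y - pairing θ z = ∑ α, ∑ h, θ α h * (y α h - z α h) := by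
    simp only [pairing, mul_sub, Finset.sum_sub_distrib]
  rw [this, Finset.sum_mul]
  refine (Finset.abs_sum_le_sum_abs _ _).trans (Finset.sum_le_sum fun α _ => ?_)
  rw [Finset.sum_mul]
  refine (Finset.abs_sum_le_sum_abs _ _).trans (Finset.sum_le_sum fun h _ => ?_)
  rw [abs_mul]
  gcongr
  exact (dist_le_pi_dist (y α) (z α) h).trans (dist_le_pi_dist y z α)

theorem logLaplace_smul (g : Matrix A A ℝ) (t : ℝ) (θ : A → Fin m → ℝ) :
    logLaplace g (t • θ) = t ^ 2 * logLaplace g θ := by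
  simp only [logLaplace, Pi.smul_apply, smul_eq_mul, Finset.mul_sum, Finset.sum_div]
  exact Finset.sum_congr rfl fun _ _ => Finset.sum_congr rfl fun _ _ =>
    Finset.sum_congr rfl fun _ _ => by ring

/-- For a symmetric matrix `s`, the space is the sum of the range and of the kernel of `s`. -/
theorem exists_mul_add_ker {s : Matrix A A ℝ} (hs : s.transpose = s)
    (z : Matrix A (Fin m) ℝ) : ∃ r k : Matrix A (Fin m) ℝ, z = s * r + k ∧ s * k = 0 := by
  let f : Matrix A (Fin m) ℝ →ₗ[ℝ] Matrix A (Fin m) ℝ :=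
    { toFun := fun r => s * r
      map_add' := fun _ _ => Matrix.mul_add _ _ _
      map_smul' := fun _ _ => Matrix.mul_smul _ _ _ }
  have hdisj : Disjoint (LinearMap.range f) (LinearMap.ker f) := by
    rw [Submodule.disjoint_def]
    rintro _ ⟨r, rfl⟩ hr
    have h1 : s * (s * r) = 0 := hr
    have h2 := pairing_mul_of_transpose_eq hs r (s * r)
    rw [h1, pairing_self] at h2
    have h3 : normSq (s * r) = 0 := by rw [← h2]; simp [pairing]
    exact eq_zero_of_normSq_eq_zero h3
  have htop : LinearMap.range f ⊔ LinearMap.ker f = ⊤ :=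
    Submodule.eq_top_of_disjoint _ _ (LinearMap.finrank_range_add_finrank_ker f).ge hdisj
  have hz : z ∈ LinearMap.range f ⊔ LinearMap.ker f := htop ▸ Submodule.mem_top
  obtain ⟨_, ⟨r, rfl⟩, k, hk, h⟩ := Submodule.mem_sup.1 hz
  exact ⟨r, k, h.symm, hk⟩

theorem isCompact_setOf_normSq_le (c : ℝ) :
    IsCompact {r : A → Fin m → ℝ | normSq (A := A) r ≤ c} := by
  refine Metric.isCompact_of_isClosed_isBounded (isClosed_le ?_ continuous_const) ?_
  · unfold normSq; fun_prop
  · refine (Metric.isBounded_iff_subset_closedBall 0).2 ⟨Real.sqrt c, fun r hr => ?_⟩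
    rw [mem_closedBall_zero_iff, pi_norm_le_iff_of_nonneg (Real.sqrt_nonneg _)]
    intro α
    rw [pi_norm_le_iff_of_nonneg (Real.sqrt_nonneg _)]
    intro h
    refine Real.abs_le_sqrt (le_trans ?_ hr)
    calc r α h ^ 2 ≤ ∑ h, r α h ^ 2 :=
          Finset.single_le_sum (f := fun h => r α h ^ 2) (fun _ _ => sq_nonneg _)
            (Finset.mem_univ h)
      _ ≤ _ := Finset.single_le_sum (f := fun α => ∑ h, r α h ^ 2)
            (fun _ _ => Finset.sum_nonneg fun _ _ => sq_nonneg _) (Finset.mem_univ α)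

theorem logLaplace_add {g : Matrix A A ℝ} (hg : g.PosSemidef) (θ₀ θ : Matrix A (Fin m) ℝ) :
    logLaplace g (θ₀ + θ) = logLaplace g θ₀ + pairing θ (g * θ₀) + logLaplace g θ := by
  have hT : g.transpose = g := by simpa [Matrix.IsHermitian] using hg.isHermitian
  have hc : pairing θ₀ (g * θ) = pairing θ (g * θ₀) := by
    rw [pairing_mul_of_transpose_eq hT]
    simp only [pairing, mul_comm]
  simp only [logLaplace_eq_pairing, Matrix.mul_add]
  have e1 : pairing (θ₀ + θ) (g * θ₀ + g * θ) =
      pairing θ₀ (g * θ₀ + g * θ) + pairing θ (g * θ₀ + g * θ) := pairing_add_left _ _ _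
  have e2 : pairing θ₀ (g * θ₀ + g * θ) = pairing θ₀ (g * θ₀) + pairing θ₀ (g * θ) :=
    pairing_add_right _ _ _
  have e3 : pairing θ (g * θ₀ + g * θ) = pairing θ (g * θ₀) + pairing θ (g * θ) :=
    pairing_add_right _ _ _
  rw [e1, e2, e3, hc]
  ring

variable [DecidableEq A]

theorem posSemidef_matSqrt (q : Matrix A A ℝ) : (matSqrt q).PosSemidef :=
  Matrix.nonneg_iff_posSemidef.1 (CFC.sqrt_nonneg q)

theorem matSqrt_transpose (q : Matrix A A ℝ) : (matSqrt q).transpose = matSqrt q := by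
  simpa [Matrix.IsHermitian] using (posSemidef_matSqrt q).isHermitian

theorem matSqrt_mul_self {q : Matrix A A ℝ} (hq : q.PosSemidef) : matSqrt q * matSqrt q = q :=
  ((matSqrt_eq_iff hq).1 rfl).2

theorem logLaplace_eq_normSq {g : Matrix A A ℝ} (hg : g.PosSemidef) (θ : Matrix A (Fin m) ℝ) :
    logLaplace g θ = normSq (matSqrt g * θ) / 2 := by
  conv_lhs => rw [logLaplace_eq_pairing, ← matSqrt_mul_self hg, Matrix.mul_assoc,
    pairing_mul_of_transpose_eq (matSqrt_transpose g), pairing_self]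

theorem logLaplace_nonneg {g : Matrix A A ℝ} (hg : g.PosSemidef) (θ : A → Fin m → ℝ) :
    0 ≤ logLaplace g θ := by
  exact (div_nonneg (normSq_nonneg _) zero_le_two).trans_eq
    (logLaplace_eq_normSq hg (Matrix.of θ)).symm

/-- At a point `z` of the range of `g^#`, the infimum that defines the rate function is attained at
`r = g^# θ` where `g θ = z`. -/
theorem exists_mdRate_eq {g : Matrix A A ℝ} (hg : g.PosSemidef) {z r : Matrix A (Fin m) ℝ}
    (hr : matSqrt g * r = z) :
    ∃ θ : Matrix A (Fin m) ℝ, g * θ = z ∧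
      mdRate g z = ENNReal.ofReal (normSq (matSqrt g * θ) / 2) := by
  obtain ⟨θ, k, hrk, hk⟩ := exists_mul_add_ker (matSqrt_transpose g) r
  have hz : matSqrt g * (matSqrt g * θ) = z := by
    rw [← hr, hrk, Matrix.mul_add, hk, add_zero]
  refine ⟨θ, by rw [← hz, ← Matrix.mul_assoc, matSqrt_mul_self hg], le_antisymm ?_ ?_⟩
  · exact iInf₂_le (matSqrt g * θ) hz
  · refine le_iInf₂ fun r' hr' => ENNReal.ofReal_le_ofReal ?_
    have hr'' : matSqrt g * r' = z := hr'
    have h1 := pairing_le_half_add_half (matSqrt g * θ) r'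
    have h2 : pairing (matSqrt g * θ) r' = normSq (matSqrt g * θ) := by
      rw [← pairing_mul_of_transpose_eq (matSqrt_transpose g), hr'', ← hz,
        pairing_mul_of_transpose_eq (matSqrt_transpose g), pairing_self]
    linarith

/-- The rate function is at most the Legendre transform of the logarithmic Laplace transform. -/
theorem exists_lt_pairing_sub_logLaplace {g : Matrix A A ℝ} (hg : g.PosSemidef)
    {z : A → Fin m → ℝ} {c : ℝ} (hc : (c : EReal) < (mdRate g z : EReal)) :
    ∃ θ : A → Fin m → ℝ, c < pairing θ z - logLaplace g θ := by
  by_cases hz : ∃ r : Matrix A (Fin m) ℝ, matSqrt g * r = Matrix.of z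
  · obtain ⟨r, hr⟩ := hz
    obtain ⟨θ, hθ, hI⟩ := exists_mdRate_eq hg hr
    refine ⟨θ, ?_⟩
    have hI' : mdRate g z = ENNReal.ofReal (normSq (matSqrt g * θ) / 2) := hI
    have hnn := normSq_nonneg (matSqrt g * θ)
    rw [hI', EReal.coe_ennreal_ofReal, max_eq_left (by positivity), EReal.coe_lt_coe_iff] at hc
    have h1 : pairing θ z = 2 * logLaplace g θ := by
      rw [logLaplace_eq_pairing, hθ]
      simp only [Matrix.of_apply, pairing]; ring
    rw [h1, logLaplace_eq_normSq hg]
    linarith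
  · obtain ⟨r, k, hrk, hk⟩ := exists_mul_add_ker (matSqrt_transpose g) (Matrix.of z)
    have hk0 : 0 < normSq k := by
      refine lt_of_le_of_ne (normSq_nonneg k) fun h => hz ⟨r, ?_⟩
      rw [hrk, eq_zero_of_normSq_eq_zero h.symm, add_zero]
    -- off the range of `g^#`, a multiple of the component `k` of `z` in the kernel will do
    have h1 : pairing k z = normSq k := by
      have e1 : pairing k z = pairing k (matSqrt g * r) + pairing k k := by
        exact (congrArg (pairing k) hrk).trans (pairing_add_right _ _ _)
      rw [e1, pairing_mul_of_transpose_eq (matSqrt_transpose g), hk, pairing_self]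
      simp [pairing]
    have h2 : logLaplace g k = 0 := by
      rw [logLaplace_eq_normSq hg, hk]; simp [normSq]
    refine ⟨((|c| + 1) / normSq k) • k, ?_⟩
    have e1 := pairing_smul_left ((|c| + 1) / normSq k) k z
    have e2 := logLaplace_smul g ((|c| + 1) / normSq k) k
    rw [h1, div_mul_cancel₀ _ hk0.ne'] at e1
    rw [h2, mul_zero] at e2
    have e3 := le_abs_self c
    refine lt_of_lt_of_eq (by linarith : c < (|c| + 1) - 0) ?_
    exact congrArg₂ (· - ·) e1.symm e2.symm

theorem isGoodRateFunction_mdRate {g : Matrix A A ℝ} (hg : g.PosSemidef) :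
    IsGoodRateFunction (mdRate (m := m) g) := by
  have hcomp : ∀ c : ℝ≥0, IsCompact {z | mdRate (m := m) g z ≤ c} := by
    intro c
    have himg : {z | mdRate (m := m) g z ≤ c} = (fun r : A → Fin m → ℝ => fun α h =>
        ∑ β, matSqrt g α β * r β h) '' {r | normSq (A := A) r ≤ 2 * c} := by
      ext z
      constructor
      · intro hz
        have hex : ∃ r : Matrix A (Fin m) ℝ, matSqrt g * r = Matrix.of z := by
          by_contra! hcon
          have : mdRate g z = ⊤ := iInf₂_eq_top.2 fun r hr => absurd hr (hcon r)
          simp [this] at hz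
        obtain ⟨r, hr⟩ := hex
        obtain ⟨θ, hθ, hI⟩ := exists_mdRate_eq hg hr
        have hI' : mdRate g z = ENNReal.ofReal (normSq (matSqrt g * θ) / 2) := hI
        refine ⟨matSqrt g * θ, ?_, ?_⟩
        · have hz' : mdRate g z ≤ c := hz
          rw [hI', ← ENNReal.ofReal_coe_nnreal,
            ENNReal.ofReal_le_ofReal_iff c.coe_nonneg] at hz'
          change normSq (matSqrt g * θ) ≤ 2 * c
          linarith
        · ext α h
          rw [← matSqrt_mul_self hg, Matrix.mul_assoc] at hθ
          simpa [Matrix.mul_apply] using congrFun (congrFun hθ α) h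
      · rintro ⟨r, hr, rfl⟩
        refine le_trans (b := ENNReal.ofReal (normSq (Matrix.of r) / 2)) (iInf₂_le _ ?_) ?_
        · ext; simp [Matrix.mul_apply]
        · rw [← ENNReal.ofReal_coe_nnreal]
          refine ENNReal.ofReal_le_ofReal ?_
          have hr' : normSq (Matrix.of r) ≤ 2 * c := hr
          linarith
    rw [himg]
    exact (isCompact_setOf_normSq_le _).image (by fun_prop)
  refine ⟨lowerSemicontinuous_iff_isClosed_preimage.2 fun y => ?_, hcomp⟩
  induction y with
  | top => simp
  | coe y => exact (hcomp y).isClosed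

theorem isUnit_matSqrt {g : Matrix A A ℝ} (hg : g.PosSemidef) (hu : IsUnit g) :
    IsUnit (matSqrt g) := by
  rw [← matSqrt_mul_self hg] at hu
  exact ((Commute.refl (matSqrt g)).isUnit_mul_iff.1 hu).1

theorem mdRate_of_isUnit_matSqrt {g : Matrix A A ℝ} (hu : IsUnit (matSqrt g))
    (z : A → Fin m → ℝ) :
    mdRate g z = ENNReal.ofReal (normSq ((matSqrt g)⁻¹ * Matrix.of z) / 2) := by
  unfold mdRate
  generalize matSqrt g = s at hu ⊢
  have hdet : IsUnit s.det := (Matrix.isUnit_iff_isUnit_det _).1 hu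
  have h1 : s * (s⁻¹ * Matrix.of z) = Matrix.of z :=
    Matrix.mul_nonsing_inv_cancel_left s (Matrix.of z) hdet
  refine le_antisymm (iInf₂_le (s⁻¹ * Matrix.of z) h1) (le_iInf₂ fun r hr => ?_)
  have h2 : s⁻¹ * Matrix.of z = r := by
    rw [← hr]
    exact Matrix.nonsing_inv_mul_cancel_left s r hdet
  rw [h2]

end Rate

/-! ### Large deviations from quadratic Laplace asymptotics -/

section LaplacePrinciple

variable {A : Type*} [Fintype A] {m : ℕ}

/-- The logarithmic Laplace transforms of `π n`, scaled by the speed `v n`, converge to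
`logLaplace g`. -/
def HasLaplaceLimit (π : ℕ → Measure (A → Fin m → ℝ)) (v : ℕ → ℝ) (g : Matrix A A ℝ) : Prop :=
  ∀ θ : A → Fin m → ℝ, ∀ ε > 0, ∀ᶠ n in atTop,
    ENNReal.ofReal (Real.exp (v n * (logLaplace g θ - ε))) ≤
        ∫⁻ y, ENNReal.ofReal (Real.exp (v n * pairing θ y)) ∂π n ∧
      ∫⁻ y, ENNReal.ofReal (Real.exp (v n * pairing θ y)) ∂π n ≤
        ENNReal.ofReal (Real.exp (v n * (logLaplace g θ + ε)))

/-- The element of the standard basis at `(α, h)`. -/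
def basisVec [DecidableEq A] (α : A) (h : Fin m) : A → Fin m → ℝ :=
  Pi.single α (Pi.single h 1)

theorem pairing_basisVec [DecidableEq A] (α : A) (h : Fin m) (y : A → Fin m → ℝ) :
    pairing (basisVec α h) y = y α h := by
  unfold pairing basisVec
  rw [Finset.sum_eq_single α, Finset.sum_eq_single h]
  · simp
  · intro b _ hb; simp [hb]
  · simp
  · intro b _ hb; simp [hb]
  · simp

theorem exists_lt_abs_of_lt_dist {y z : A → Fin m → ℝ} {R : ℝ} (hR : 0 ≤ R) (h : R < dist y z) :
    ∃ α k, R < |y α k - z α k| := by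
  by_contra! hcon
  refine absurd h (not_lt.2 ((dist_pi_le_iff hR).2 fun α => (dist_pi_le_iff hR).2 fun k => ?_))
  exact hcon α k

theorem exists_le_abs_of_le_dist {y z : A → Fin m → ℝ} {R : ℝ} (hR : 0 < R) (h : R ≤ dist y z) :
    ∃ α k, R ≤ |y α k - z α k| := by
  by_contra! hcon
  refine absurd h (not_le.2 ((dist_pi_lt_iff hR).2 fun α => (dist_pi_lt_iff hR).2 fun k => ?_))
  exact hcon α k

/-- Finitely many half-spaces cover a closed set on which the Legendre transform exceeds `c`: the
complement of a large ball is covered by half-spaces orthogonal to the coordinate axes, the rest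
is compact. -/
theorem exists_finset_halfSpace_cover (g : Matrix A A ℝ) {C : Set (A → Fin m → ℝ)}
    (hC : IsClosed C) {c : ℝ} (hc : ∀ z ∈ C, ∃ θ, c < pairing θ z - logLaplace g θ) :
    ∃ T : Finset (A → Fin m → ℝ), C ⊆ ⋃ θ ∈ T, {y | c < pairing θ y - logLaplace g θ} := by
  classical
  -- `M` bounds `logLaplace g` on the basis; outside the ball of radius `|c| + M`, some coordinate
  -- exceeds `|c| + M` in absolute value
  set M : ℝ := ∑ α : A, ∑ h : Fin m, |logLaplace g (basisVec α h)|
  have hM : ∀ (α : A) (h : Fin m), |logLaplace g (basisVec (A := A) α h)| ≤ M := fun α h =>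
    (Finset.single_le_sum (f := fun h => |logLaplace g (basisVec (A := A) α h)|)
      (fun _ _ => abs_nonneg _) (Finset.mem_univ h)).trans
    (Finset.single_le_sum (f := fun α => ∑ h, |logLaplace g (basisVec (A := A) α h)|)
      (fun _ _ => Finset.sum_nonneg fun _ _ => abs_nonneg _) (Finset.mem_univ α))
  have hM0 : 0 ≤ M := Finset.sum_nonneg fun _ _ => Finset.sum_nonneg fun _ _ => abs_nonneg _
  have hK : IsCompact (C ∩ Metric.closedBall 0 (|c| + M)) :=
    (isCompact_closedBall _ _).inter_left hC
  obtain ⟨T, hT⟩ := hK.elim_finite_subcover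
    (fun θ : A → Fin m → ℝ => {y | c < pairing θ y - logLaplace g θ})
    (fun θ => isOpen_lt continuous_const ((continuous_pairing θ).sub continuous_const))
    (fun z hz => by
      obtain ⟨θ, hθ⟩ := hc z hz.1
      exact Set.mem_iUnion.2 ⟨θ, hθ⟩)
  let T' : Finset (A → Fin m → ℝ) := Finset.univ.image fun p : A × Fin m => basisVec p.1 p.2
  refine ⟨T ∪ T' ∪ T'.image (fun θ => (-1 : ℝ) • θ), fun y hy => ?_⟩
  simp only [Set.mem_iUnion, Set.mem_ofPred_eq, exists_prop]
  by_cases hyb : dist y 0 ≤ |c| + M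
  · obtain ⟨θ, hθ, h⟩ := Set.mem_iUnion₂.1 (hT ⟨hy, hyb⟩)
    exact ⟨θ, by simp [hθ], h⟩
  · obtain ⟨α, h, hαh⟩ := exists_lt_abs_of_lt_dist (by positivity) (not_le.1 hyb)
    have h1 := hM α h
    have h2 := le_abs_self (logLaplace g (basisVec α h))
    have h3 := le_abs_self c
    have hmem : basisVec α h ∈ T' := Finset.mem_image.2 ⟨(α, h), Finset.mem_univ _, rfl⟩
    simp only [Pi.zero_apply, sub_zero] at hαh
    rcases lt_abs.1 hαh with hpos | hneg
    · refine ⟨basisVec α h, by simp [hmem], ?_⟩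
      rw [pairing_basisVec]; linarith
    · refine ⟨(-1 : ℝ) • basisVec α h,
        Finset.mem_union_right _ (Finset.mem_image_of_mem _ hmem), ?_⟩
      rw [pairing_smul_left, pairing_basisVec, logLaplace_smul]; linarith

theorem measurable_expPairing (c : ℝ) (θ : A → Fin m → ℝ) :
    Measurable fun y : A → Fin m → ℝ => ENNReal.ofReal (Real.exp (c * pairing θ y)) :=
  (by fun_prop : Continuous fun y => Real.exp (c * pairing θ y)).measurable.ennreal_ofReal

theorem ofReal_exp_mul_ofReal_exp (a b : ℝ) :
    ENNReal.ofReal (Real.exp a) * ENNReal.ofReal (Real.exp b) =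
      ENNReal.ofReal (Real.exp (a + b)) := by
  rw [← ENNReal.ofReal_mul (Real.exp_nonneg _), Real.exp_add]

/-- Constant factors do not matter on the exponential scale. -/
theorem eventually_natCast_mul_exp_le {v : ℕ → ℝ} (hv : IsSpeed v) (N : ℕ) {a b : ℝ}
    (hab : a < b) : ∀ᶠ n in atTop, (N : ℝ≥0∞) * ENNReal.ofReal (Real.exp (v n * a)) ≤
      ENNReal.ofReal (Real.exp (v n * b)) := by
  have h1 : Tendsto (fun n => Real.exp (v n * (b - a))) atTop atTop :=
    Real.tendsto_exp_atTop.comp (hv.2.atTop_mul_const (by linarith))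
  filter_upwards [h1.eventually_ge_atTop (N : ℝ)] with n hn
  rw [← ENNReal.ofReal_natCast, ← ENNReal.ofReal_mul (Nat.cast_nonneg _)]
  refine ENNReal.ofReal_le_ofReal ?_
  calc (N : ℝ) * Real.exp (v n * a) ≤ Real.exp (v n * (b - a)) * Real.exp (v n * a) := by gcongr
    _ = Real.exp (v n * b) := by rw [← Real.exp_add]; ring_nf

/-- The large deviation upper bound, by a Chernoff bound on each half-space of the cover. -/
theorem measure_closed_le {g : Matrix A A ℝ} {π : ℕ → Measure (A → Fin m → ℝ)} {v : ℕ → ℝ}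
    (hv : IsSpeed v) (hπ : HasLaplaceLimit π v g) {C : Set (A → Fin m → ℝ)} (hC : IsClosed C)
    {c : ℝ} (hc : ∀ z ∈ C, ∃ θ, c < pairing θ z - logLaplace g θ) {ε : ℝ} (hε : 0 < ε) :
    ∀ᶠ n in atTop, π n C ≤ ENNReal.ofReal (Real.exp (v n * (-c + ε))) := by
  obtain ⟨T, hT⟩ := exists_finset_halfSpace_cover g hC hc
  have hall : ∀ᶠ n in atTop, ∀ θ ∈ T,
      ∫⁻ y, ENNReal.ofReal (Real.exp (v n * pairing θ y)) ∂π n ≤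
        ENNReal.ofReal (Real.exp (v n * (logLaplace g θ + ε / 2))) :=
    (Filter.eventually_all_finset T).2 fun θ _ =>
      (hπ θ (ε / 2) (by linarith)).mono fun _ h => h.2
  filter_upwards [hall, eventually_natCast_mul_exp_le hv T.card
    (by linarith : -c + ε / 2 < -c + ε)] with n hn hcard
  have hhalf : ∀ θ ∈ T, π n {y | c < pairing θ y - logLaplace g θ} ≤
      ENNReal.ofReal (Real.exp (v n * (-c + ε / 2))) := by
    intro θ hθ
    calc π n {y | c < pairing θ y - logLaplace g θ}
        = ∫⁻ _ in {y | c < pairing θ y - logLaplace g θ}, 1 ∂π n := by simp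
      _ ≤ ∫⁻ y in {y | c < pairing θ y - logLaplace g θ},
            ENNReal.ofReal (Real.exp (v n * (-c - logLaplace g θ))) *
              ENNReal.ofReal (Real.exp (v n * pairing θ y)) ∂π n := by
          refine setLIntegral_mono ((measurable_expPairing _ _).const_mul _) fun y hy => ?_
          rw [ofReal_exp_mul_ofReal_exp, ← ENNReal.ofReal_one]
          refine ENNReal.ofReal_le_ofReal (Real.one_le_exp ?_)
          have hy' : c < pairing θ y - logLaplace g θ := hy
          have := mul_nonneg (hv.1 n).le (sub_nonneg.2 hy'.le)
          linarith
      _ ≤ ENNReal.ofReal (Real.exp (v n * (-c - logLaplace g θ))) *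
            ENNReal.ofReal (Real.exp (v n * (logLaplace g θ + ε / 2))) := by
          refine (setLIntegral_le_lintegral _ _).trans ?_
          rw [lintegral_const_mul _ (measurable_expPairing _ _)]
          gcongr
          exact hn θ hθ
      _ = _ := by rw [ofReal_exp_mul_ofReal_exp]; ring_nf
  calc π n C ≤ π n (⋃ θ ∈ T, {y | c < pairing θ y - logLaplace g θ}) := measure_mono hT
    _ ≤ ∑ θ ∈ T, π n {y | c < pairing θ y - logLaplace g θ} := measure_biUnion_finset_le _ _
    _ ≤ ∑ _θ ∈ T, ENNReal.ofReal (Real.exp (v n * (-c + ε / 2))) := Finset.sum_le_sum hhalf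
    _ ≤ _ := by rw [Finset.sum_const, nsmul_eq_mul]; exact hcard

/-- Under the measure tilted by `exp (v n * pairing θ₀ y)`, the mass concentrates at the
gradient `z` of `logLaplace g` at `θ₀`. The exponential rate `κ` comes from Chernoff bounds in the
directions of the coordinate axes. -/
theorem tilted_compl_ball_le {g : Matrix A A ℝ} (hg : g.PosSemidef)
    {π : ℕ → Measure (A → Fin m → ℝ)} {v : ℕ → ℝ}
    (hv : IsSpeed v) (hπ : HasLaplaceLimit π v g) {θ₀ z : A → Fin m → ℝ}
    (hz : ∀ θ, logLaplace g (θ₀ + θ) = logLaplace g θ₀ + pairing θ z + logLaplace g θ)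
    {η : ℝ} (hη : 0 < η) :
    ∃ κ > 0, ∀ᶠ n in atTop, ∫⁻ y in {y | η ≤ dist y z},
        ENNReal.ofReal (Real.exp (v n * pairing θ₀ y)) ∂π n ≤
      ENNReal.ofReal (Real.exp (v n * (logLaplace g θ₀ - κ))) := by
  classical
  set M : ℝ := 1 + ∑ α : A, ∑ h : Fin m, logLaplace g (basisVec α h)
  have hM : ∀ (α : A) (h : Fin m), logLaplace g (basisVec (A := A) α h) ≤ M := fun α h => by
    have h1 := (Finset.single_le_sum (f := fun h => logLaplace g (basisVec (A := A) α h))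
      (fun _ _ => logLaplace_nonneg hg _) (Finset.mem_univ h)).trans
      (Finset.single_le_sum (f := fun α => ∑ h, logLaplace g (basisVec (A := A) α h))
        (fun _ _ => Finset.sum_nonneg fun _ _ => logLaplace_nonneg hg _) (Finset.mem_univ α))
    linarith
  have hM0 : 0 < M := add_pos_of_pos_of_nonneg one_pos
    (Finset.sum_nonneg fun _ _ => Finset.sum_nonneg fun _ _ => logLaplace_nonneg hg _)
  -- `t` minimizes `t ^ 2 * M - t * η`
  set t : ℝ := η / (2 * M)
  have ht : 0 < t := by positivity
  set κ : ℝ := η ^ 2 / (16 * M)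
  have hκ : 0 < κ := by positivity
  have htκ : t ^ 2 * M - t * η = -(4 * κ) := by
    simp only [t, κ]; field_simp; ring
  let T : Finset (A → Fin m → ℝ) := (Finset.univ : Finset ((A × Fin m) × Bool)).image fun p =>
    (if p.2 then t else -t) • basisVec p.1.1 p.1.2
  have hTΛ : ∀ θ ∈ T, logLaplace g θ ≤ t ^ 2 * M := by
    intro θ hθ
    obtain ⟨⟨⟨α, h⟩, b⟩, -, rfl⟩ := Finset.mem_image.1 hθ
    rw [logLaplace_smul]
    have : (if b then t else -t) ^ 2 = t ^ 2 := by cases b <;> simp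
    simp only [this]
    exact mul_le_mul_of_nonneg_left (hM α h) (sq_nonneg t)
  have hcover : {y | η ≤ dist y z} ⊆ ⋃ θ ∈ T, {y | t * η ≤ pairing θ y - pairing θ z} := by
    intro y hy
    obtain ⟨α, h, hαh⟩ := exists_le_abs_of_le_dist hη hy
    simp only [Set.mem_iUnion, Set.mem_ofPred_eq, exists_prop]
    rcases le_abs.1 hαh with hpos | hneg
    · refine ⟨t • basisVec α h, Finset.mem_image.2 ⟨((α, h), true), Finset.mem_univ _, by simp⟩, ?_⟩
      simp only [pairing_smul_left, pairing_basisVec]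
      have := mul_le_mul_of_nonneg_left hpos ht.le
      linarith
    · refine ⟨(-t) • basisVec α h,
        Finset.mem_image.2 ⟨((α, h), false), Finset.mem_univ _, by simp⟩, ?_⟩
      simp only [pairing_smul_left, pairing_basisVec]
      have := mul_le_mul_of_nonneg_left hneg ht.le
      linarith
  refine ⟨κ, hκ, ?_⟩
  have hall : ∀ᶠ n in atTop, ∀ θ ∈ T,
      ∫⁻ y, ENNReal.ofReal (Real.exp (v n * pairing (θ₀ + θ) y)) ∂π n ≤
        ENNReal.ofReal (Real.exp (v n * (logLaplace g (θ₀ + θ) + κ))) :=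
    (Filter.eventually_all_finset T).2 fun θ _ => (hπ (θ₀ + θ) κ hκ).mono fun _ h => h.2
  filter_upwards [hall, eventually_natCast_mul_exp_le hv T.card
    (by linarith : logLaplace g θ₀ - 2 * κ < logLaplace g θ₀ - κ)] with n hn hcard
  have hhalf : ∀ θ ∈ T, ∫⁻ y in {y | t * η ≤ pairing θ y - pairing θ z},
      ENNReal.ofReal (Real.exp (v n * pairing θ₀ y)) ∂π n ≤
      ENNReal.ofReal (Real.exp (v n * (logLaplace g θ₀ - 2 * κ))) := by
    intro θ hθ
    calc ∫⁻ y in {y | t * η ≤ pairing θ y - pairing θ z},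
          ENNReal.ofReal (Real.exp (v n * pairing θ₀ y)) ∂π n
        ≤ ∫⁻ y in {y | t * η ≤ pairing θ y - pairing θ z},
            ENNReal.ofReal (Real.exp (v n * (-pairing θ z - t * η))) *
              ENNReal.ofReal (Real.exp (v n * pairing (θ₀ + θ) y)) ∂π n := by
          refine setLIntegral_mono ((measurable_expPairing _ _).const_mul _) fun y hy => ?_
          rw [ofReal_exp_mul_ofReal_exp, pairing_add_left]
          refine ENNReal.ofReal_le_ofReal (Real.exp_le_exp.2 ?_)
          have hy' : t * η ≤ pairing θ y - pairing θ z := hy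
          have := mul_nonneg (hv.1 n).le (sub_nonneg.2 hy')
          linarith
      _ ≤ ENNReal.ofReal (Real.exp (v n * (-pairing θ z - t * η))) *
            ENNReal.ofReal (Real.exp (v n * (logLaplace g (θ₀ + θ) + κ))) := by
          refine (setLIntegral_le_lintegral _ _).trans ?_
          rw [lintegral_const_mul _ (measurable_expPairing _ _)]
          gcongr
          exact hn θ hθ
      _ ≤ _ := by
          rw [ofReal_exp_mul_ofReal_exp, ← mul_add]
          refine ENNReal.ofReal_le_ofReal (Real.exp_le_exp.2 ?_)
          refine mul_le_mul_of_nonneg_left ?_ (hv.1 n).le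
          have h1 := hz θ
          have h2 := hTΛ θ hθ
          linarith
  calc ∫⁻ y in {y | η ≤ dist y z}, ENNReal.ofReal (Real.exp (v n * pairing θ₀ y)) ∂π n
      ≤ ∫⁻ y in ⋃ θ ∈ T, {y | t * η ≤ pairing θ y - pairing θ z},
          ENNReal.ofReal (Real.exp (v n * pairing θ₀ y)) ∂π n := lintegral_mono_set hcover
    _ ≤ ∑ θ ∈ T, ∫⁻ y in {y | t * η ≤ pairing θ y - pairing θ z},
          ENNReal.ofReal (Real.exp (v n * pairing θ₀ y)) ∂π n := by
        have hmeas : ∀ θ : A → Fin m → ℝ,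
            MeasurableSet {y | t * η ≤ pairing θ y - pairing θ z} := fun θ =>
          (isClosed_le continuous_const
            ((continuous_pairing θ).sub continuous_const)).measurableSet
        rw [← withDensity_apply _ (T.measurableSet_biUnion fun θ _ => hmeas θ)]
        refine (measure_biUnion_finset_le _ _).trans_eq ?_
        exact Finset.sum_congr rfl fun θ _ => withDensity_apply _ (hmeas θ)
    _ ≤ ∑ _θ ∈ T, ENNReal.ofReal (Real.exp (v n * (logLaplace g θ₀ - 2 * κ))) :=
        Finset.sum_le_sum hhalf
    _ ≤ _ := by rw [Finset.sum_const, nsmul_eq_mul]; exact hcard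

/-- The large deviation lower bound at a gradient `z` of `logLaplace g`, where the value of the
rate function is `logLaplace g θ₀`: the tilted mass is carried by a small ball around `z`, on which
the tilting density is nearly constant. -/
theorem le_measure_ball {g : Matrix A A ℝ} (hg : g.PosSemidef)
    {π : ℕ → Measure (A → Fin m → ℝ)} {v : ℕ → ℝ}
    (hv : IsSpeed v) (hπ : HasLaplaceLimit π v g) {θ₀ z : A → Fin m → ℝ}
    (hz : ∀ θ, logLaplace g (θ₀ + θ) = logLaplace g θ₀ + pairing θ z + logLaplace g θ) {η ε : ℝ}
    (hη : 0 < η) (hε : 0 < ε) :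
    ∀ᶠ n in atTop, ENNReal.ofReal (Real.exp (v n * (-logLaplace g θ₀ - ε))) ≤
      π n (Metric.ball z η) := by
  have hz₀ : pairing θ₀ z = 2 * logLaplace g θ₀ := by
    have h1 := hz θ₀
    rw [← two_smul ℝ θ₀, logLaplace_smul] at h1
    linarith
  set N : ℝ := ∑ α, ∑ h, |θ₀ α h|
  have hN : 0 ≤ N := Finset.sum_nonneg fun _ _ => Finset.sum_nonneg fun _ _ => abs_nonneg _
  -- on a ball of radius `η'`, the tilt `pairing θ₀` varies by less than `ε / 2`
  set η' : ℝ := min η (ε / (2 * (N + 1)))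
  have hη' : 0 < η' := lt_min hη (by positivity)
  have hNη : N * η' ≤ ε / 2 := by
    calc N * η' ≤ (N + 1) * (ε / (2 * (N + 1))) := by
          gcongr
          · linarith
          · exact min_le_right _ _
      _ = ε / 2 := by field_simp
  obtain ⟨κ, hκ, htail⟩ := tilted_compl_ball_le hg hv hπ hz hη'
  set δ : ℝ := min (κ / 2) (ε / 4)
  have hδ : 0 < δ := lt_min (by linarith) (by linarith)
  have hδκ : δ ≤ κ / 2 := min_le_left _ _
  have hδε : δ ≤ ε / 4 := min_le_right _ _
  filter_upwards [htail, (hπ θ₀ δ hδ).mono fun _ h => h.1,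
    eventually_natCast_mul_exp_le hv 2 (by linarith : logLaplace g θ₀ - κ < logLaplace g θ₀ - δ),
    eventually_natCast_mul_exp_le hv 2 (by linarith : -logLaplace g θ₀ - ε <
      -logLaplace g θ₀ - 3 * ε / 4)] with n htail hlow hκn hεn
  set X : ℝ≥0∞ := ENNReal.ofReal (Real.exp (v n * (logLaplace g θ₀ - δ)))
  set Y : ℝ≥0∞ := ENNReal.ofReal (Real.exp (v n * (logLaplace g θ₀ - κ)))
  set E : ℝ≥0∞ := ENNReal.ofReal (Real.exp (v n * (2 * logLaplace g θ₀ + ε / 2)))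
  have hball : ∫⁻ y in Metric.ball z η', ENNReal.ofReal (Real.exp (v n * pairing θ₀ y)) ∂π n ≤
      E * π n (Metric.ball z η') := by
    rw [← setLIntegral_const]
    refine setLIntegral_mono measurable_const fun y hy => ?_
    refine ENNReal.ofReal_le_ofReal (Real.exp_le_exp.2 (mul_le_mul_of_nonneg_left ?_ (hv.1 n).le))
    have h1 := (le_abs_self _).trans (abs_pairing_sub_le θ₀ y z)
    have h2 : N * dist y z ≤ N * η' := mul_le_mul_of_nonneg_left (le_of_lt hy) hN
    linarith
  have hcompl : (Metric.ball z η')ᶜ = {y | η' ≤ dist y z} := by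
    ext y; simp
  have hsum : X ≤ E * π n (Metric.ball z η') + Y := by
    refine hlow.trans ?_
    rw [← lintegral_add_compl _ (Metric.isOpen_ball (x := z) (ε := η')).measurableSet, hcompl]
    exact add_le_add hball htail
  have h2Y : 2 * Y ≤ X := by exact_mod_cast hκn
  have h2X : X ≤ 2 * (E * π n (Metric.ball z η')) := by
    have hYtop : 2 * Y ≠ ⊤ := ENNReal.mul_ne_top (by simp) ENNReal.ofReal_ne_top
    have hYt : X ≠ ⊤ := ENNReal.ofReal_ne_top
    have h3 : X + X ≤ 2 * (E * π n (Metric.ball z η')) + X := by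
      calc X + X = 2 * X := (two_mul _).symm
        _ ≤ 2 * (E * π n (Metric.ball z η') + Y) := by gcongr
        _ = 2 * (E * π n (Metric.ball z η')) + 2 * Y := mul_add _ _ _
        _ ≤ _ := by gcongr
    exact (ENNReal.add_le_add_iff_right hYt).1 h3
  have hEinv : E * ENNReal.ofReal (Real.exp (v n * -(2 * logLaplace g θ₀ + ε / 2))) = 1 := by
    rw [ofReal_exp_mul_ofReal_exp, ← mul_add, add_neg_cancel]; simp
  set E' : ℝ≥0∞ := ENNReal.ofReal (Real.exp (v n * -(2 * logLaplace g θ₀ + ε / 2)))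
  have h2ε : 2 * ENNReal.ofReal (Real.exp (v n * (-logLaplace g θ₀ - ε))) ≤
      2 * π n (Metric.ball z η') := by
    calc 2 * ENNReal.ofReal (Real.exp (v n * (-logLaplace g θ₀ - ε)))
        ≤ ENNReal.ofReal (Real.exp (v n * (-logLaplace g θ₀ - 3 * ε / 4))) := by
          exact_mod_cast hεn
      _ ≤ X * E' := by
          rw [ofReal_exp_mul_ofReal_exp, ← mul_add]
          refine ENNReal.ofReal_le_ofReal (Real.exp_le_exp.2
            (mul_le_mul_of_nonneg_left ?_ (hv.1 n).le))
          linarith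
      _ ≤ 2 * (E * π n (Metric.ball z η')) * E' := by gcongr
      _ = 2 * π n (Metric.ball z η') * (E * E') := by ring
      _ = 2 * π n (Metric.ball z η') := by rw [hEinv, mul_one]
  refine ((ENNReal.mul_le_mul_iff_right (by simp) (by simp)).1 h2ε).trans ?_
  exact measure_mono (Metric.ball_subset_ball (min_le_left _ _))

theorem one_div_mul_log_ofReal_exp {v : ℝ} (hv : 0 < v) (c : ℝ) :
    ((1 / v : ℝ) : EReal) * ENNReal.log (ENNReal.ofReal (Real.exp (v * c))) = c := by
  rw [ENNReal.log_ofReal_of_pos (Real.exp_pos _), Real.log_exp, ← EReal.coe_mul]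
  congr 1
  field_simp

/-- A version of the Gärtner–Ellis theorem: the quadratic limit `logLaplace g` is differentiable
everywhere, so that no exposed points have to be singled out, even for a singular `g`. -/
theorem satisfiesLDP_of_hasLaplaceLimit [DecidableEq A] {g : Matrix A A ℝ} (hg : g.PosSemidef)
    {π : ℕ → Measure (A → Fin m → ℝ)} (hprob : ∀ n, IsProbabilityMeasure (π n)) {v : ℕ → ℝ}
    (hv : IsSpeed v) (hπ : HasLaplaceLimit π v g) : SatisfiesLDP π v (mdRate g) where
  prob := hprob
  speed := hv
  lsc := (isGoodRateFunction_mdRate hg).1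
  upper C hC := by
    rw [EReal.le_neg]
    refine EReal.ge_of_forall_gt_iff_ge.1 fun c hc => ?_
    rw [EReal.le_neg]
    have hc' : ∀ z ∈ C, ∃ θ, c < pairing θ z - logLaplace g θ := fun z hz =>
      exists_lt_pairing_sub_logLaplace hg
        (hc.trans_le (EReal.coe_ennreal_le_coe_ennreal_iff.2 (iInf₂_le z hz)))
    refine EReal.le_of_forall_lt_iff_le.1 fun u hu => ?_
    have hu' : -c < u := by exact_mod_cast hu
    refine limsup_le_of_le (by isBoundedDefault) ?_
    filter_upwards [measure_closed_le hv hπ hC hc' (by linarith : 0 < u + c)] with n hn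
    have h0 : (0 : EReal) ≤ ((1 / v n : ℝ) : EReal) := by
      exact_mod_cast (one_div_pos.2 (hv.1 n)).le
    calc ((1 / v n : ℝ) : EReal) * ENNReal.log (π n C)
        ≤ ((1 / v n : ℝ) : EReal) *
            ENNReal.log (ENNReal.ofReal (Real.exp (v n * (-c + (u + c))))) := by
          gcongr
      _ = u := by rw [one_div_mul_log_ofReal_exp (hv.1 n)]; norm_cast; ring
  lower O hO := by
    rw [EReal.neg_le]
    refine EReal.le_of_forall_lt_iff_le.1 fun u hu => ?_
    rw [EReal.neg_le]
    have hex : ∃ z ∈ O, (mdRate g z : EReal) < u := by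
      by_contra! hcon
      refine absurd hu (not_lt.2 ?_)
      have h0 : ENNReal.ofReal u ≤ ⨅ z ∈ O, mdRate g z := le_iInf₂ fun z hz => by
        have h1 : ((ENNReal.ofReal u : ℝ≥0∞) : EReal) ≤ (mdRate g z : EReal) := by
          rw [EReal.coe_ennreal_ofReal]
          have h2 : (0 : EReal) ≤ (mdRate g z : EReal) := EReal.coe_ennreal_nonneg _
          rcases le_total u 0 with h | h
          · rw [max_eq_right h]; exact h2
          · rw [max_eq_left h]; exact hcon z hz
        exact EReal.coe_ennreal_le_coe_ennreal_iff.1 h1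
      calc (u : EReal) ≤ ((ENNReal.ofReal u : ℝ≥0∞) : EReal) := by
            rw [EReal.coe_ennreal_ofReal]; exact_mod_cast le_max_left _ _
        _ ≤ _ := EReal.coe_ennreal_le_coe_ennreal_iff.2 h0
    obtain ⟨z, hzO, hzu⟩ := hex
    obtain ⟨r, hr⟩ : ∃ r : Matrix A (Fin m) ℝ, matSqrt g * r = Matrix.of z := by
      by_contra! hcon
      have : mdRate g z = ⊤ := iInf₂_eq_top.2 fun r hr => absurd hr (hcon r)
      rw [this] at hzu
      exact absurd hzu (by simp)
    obtain ⟨θ, hθ, hI⟩ := exists_mdRate_eq hg hr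
    have hI' : mdRate g z = ENNReal.ofReal (normSq (matSqrt g * θ) / 2) := hI
    rw [hI', EReal.coe_ennreal_ofReal,
      max_eq_left (div_nonneg (normSq_nonneg _) zero_le_two), ← logLaplace_eq_normSq hg,
      EReal.coe_lt_coe_iff] at hzu
    obtain ⟨η, hη, hball⟩ := Metric.isOpen_iff.1 hO z hzO
    refine le_liminf_of_le (by isBoundedDefault) ?_
    have hgrad : ∀ θ', logLaplace g ((show A → Fin m → ℝ from θ) + θ') =
        logLaplace g θ + pairing θ' z + logLaplace g θ' := fun θ' => by
      refine (logLaplace_add hg θ (Matrix.of θ')).trans ?_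
      rw [hθ]
      rfl
    filter_upwards [le_measure_ball hg hv hπ hgrad hη (sub_pos.2 hzu)] with n hn
    have h0 : (0 : EReal) ≤ ((1 / v n : ℝ) : EReal) := by
      exact_mod_cast (one_div_pos.2 (hv.1 n)).le
    calc (-(u : EReal)) = ((1 / v n : ℝ) : EReal) * ENNReal.log (ENNReal.ofReal
            (Real.exp (v n * (-logLaplace g θ - (u - logLaplace g θ))))) := by
          rw [one_div_mul_log_ofReal_exp (hv.1 n)]; norm_cast; ring
      _ ≤ ((1 / v n : ℝ) : EReal) * ENNReal.log (π n O) := by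
          have hmono : ENNReal.ofReal
              (Real.exp (v n * (-logLaplace g θ - (u - logLaplace g θ)))) ≤ π n O :=
            hn.trans (measure_mono hball)
          gcongr

end LaplacePrinciple

/-! ### Gaussian vectors and the covariance map -/

section GaussianVectors

variable {A ι : Type*} [Fintype ι]

/-- The linear map `y ↦ ∑ᵢ yᵢ cᵢ`. -/
def linComb (c : ι → A → ℝ) (y : ι → ℝ) : A → ℝ := fun α => ∑ i, y i * c i α

theorem continuous_linComb (c : ι → A → ℝ) : Continuous (linComb c) := by
  unfold linComb; fun_prop

variable [Fintype A]

/-- Integration of a product of functions of the different coordinates of a product measure. -/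
theorem lintegral_pi_prod_eq_prod_lintegral {X : ι → Type*} {mX : ∀ i, MeasurableSpace (X i)}
    (μ : ∀ i, Measure (X i)) [∀ i, IsProbabilityMeasure (μ i)] {f : ∀ i, X i → ℝ≥0∞}
    (hf : ∀ i, Measurable (f i)) :
    ∫⁻ y, ∏ i, f i (y i) ∂Measure.pi μ = ∏ i, ∫⁻ y, f i y ∂μ i := by
  have hind : iIndepFun (fun i (y : ∀ i, X i) => f i (y i)) (Measure.pi μ) :=
    iIndepFun_pi fun i => (hf i).aemeasurable
  rw [lintegral_prod_eq_prod_lintegral_of_indepFun Finset.univ _ hind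
    fun i => (hf i).comp (measurable_pi_apply i)]
  refine Finset.prod_congr rfl fun i _ => ?_
  exact (measurePreserving_eval μ i).lintegral_comp (hf i)

theorem sum_mul_linComb (θ : A → ℝ) (c : ι → A → ℝ) (y : ι → ℝ) :
    ∑ α, θ α * linComb c y α = ∑ i, (∑ α, θ α * c i α) * y i := by
  simp only [linComb, Finset.mul_sum, Finset.sum_mul]
  rw [Finset.sum_comm]
  exact Finset.sum_congr rfl fun _ _ => Finset.sum_congr rfl fun _ _ => by ring

theorem sum_mul_sq_eq (v : ι → ℝ) (θ : A → ℝ) (c : ι → A → ℝ) :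
    ∑ i, v i * (∑ α, θ α * c i α) ^ 2 =
      ∑ α, ∑ β, θ α * θ β * ∑ i, v i * (c i α * c i β) := by
  simp_rw [sq, Finset.sum_mul_sum]
  simp only [Finset.mul_sum]
  rw [Finset.sum_comm]
  refine Finset.sum_congr rfl fun _ _ => ?_
  rw [Finset.sum_comm]
  exact Finset.sum_congr rfl fun _ _ => Finset.sum_congr rfl fun _ _ => by ring

/-- The characteristic function of a linear image of independent centered Gaussian variables depends
on the covariances only. -/
theorem charFunDual_map_linComb [DecidableEq A] (v : ι → ℝ≥0) (c : ι → A → ℝ)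
    (ℓ : StrongDual ℝ (A → ℝ)) :
    charFunDual ((Measure.pi fun i => gaussianReal 0 (v i)).map (linComb c)) ℓ =
      Complex.exp (-((∑ α, ∑ β, ℓ (Pi.single α 1) * ℓ (Pi.single β 1) *
        ∑ i, (v i : ℝ) * (c i α * c i β)) / 2 : ℝ)) := by
  set a : A → ℝ := fun α => ℓ (Pi.single α 1)
  obtain ⟨d, hd⟩ : ∃ d : ι → ℝ, ∀ i, ∑ α, a α * c i α = d i := ⟨_, fun _ => rfl⟩
  have hℓ : ∀ y, ℓ (linComb c y) = ∑ i, d i * y i := by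
    intro y
    simp_rw [← hd]
    rw [← sum_mul_linComb]
    conv_lhs => rw [← Finset.univ_sum_single (linComb c y)]
    rw [map_sum]
    refine Finset.sum_congr rfl fun α _ => ?_
    have h1 : (Pi.single α (linComb c y α) : A → ℝ) = linComb c y α • Pi.single α (1 : ℝ) := by
      rw [← Pi.single_smul, smul_eq_mul, mul_one]
    rw [h1, map_smul, smul_eq_mul, mul_comm]
  have hs := sum_mul_sq_eq (fun i => (v i : ℝ)) a c
  simp only [hd] at hs
  change _ = Complex.exp (-((∑ α, ∑ β, a α * a β * ∑ i, (v i : ℝ) * (c i α * c i β)) / 2 : ℝ))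
  rw [charFunDual_apply, integral_map (continuous_linComb c).aemeasurable (by fun_prop), ← hs]
  simp_rw [hℓ]
  have h1 : ∀ y : ι → ℝ, Complex.exp ((∑ i, d i * y i : ℝ) * Complex.I) =
      ∏ i, Complex.exp ((d i : ℂ) * (y i : ℂ) * Complex.I) := by
    intro y
    rw [← Complex.exp_sum, ← Finset.sum_mul]
    push_cast
    rfl
  have h2 : ∀ i, ∫ y : ℝ, Complex.exp ((d i : ℂ) * (y : ℂ) * Complex.I) ∂gaussianReal 0 (v i) =
      Complex.exp ((-((v i : ℝ) * d i ^ 2 / 2) : ℝ) : ℂ) := by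
    intro i
    have h3 := charFun_gaussianReal (μ := 0) (v := v i) (d i)
    rw [charFun_apply_real] at h3
    rw [h3]
    push_cast
    congr 1
    ring
  simp_rw [h1]
  rw [integral_fintype_prod_eq_prod (𝕜 := ℂ)
    (f := fun i (y : ℝ) => Complex.exp ((d i : ℂ) * (y : ℂ) * Complex.I))]
  simp_rw [h2]
  rw [← Complex.exp_sum, ← Complex.ofReal_sum, Finset.sum_neg_distrib, ← Finset.sum_div,
    ← Complex.ofReal_neg]

/-- A covariance matrix is positive semidefinite. -/
theorem posSemidef_of_forall {q : Matrix A A ℝ} (hsymm : ∀ α β, q α β = q β α)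
    (h : ∀ θ : A → ℝ, 0 ≤ ∑ α, ∑ β, θ α * θ β * q α β) : q.PosSemidef := by
  refine Matrix.PosSemidef.of_dotProduct_mulVec_nonneg (Matrix.ext fun α β => by simp [hsymm α β])
    fun θ => ?_
  refine (h θ).trans_eq ?_
  simp only [dotProduct, Matrix.mulVec, Finset.mul_sum, Pi.star_apply, star_trivial]
  exact Finset.sum_congr rfl fun _ _ => Finset.sum_congr rfl fun _ _ => by ring

/-- The map `q ↦ C_b + c q` preserves positive semidefiniteness. -/
theorem posSemidef_const_add_mul {Cb c : ℝ} (hCb : 0 ≤ Cb) (hc : 0 ≤ c) {q : Matrix A A ℝ}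
    (hq : q.PosSemidef) : (Matrix.of fun α β => Cb + c * q α β : Matrix A A ℝ).PosSemidef := by
  have hq' : ∀ θ : A → ℝ, 0 ≤ ∑ α, ∑ β, θ α * θ β * q α β := by
    intro θ
    refine (hq.dotProduct_mulVec_nonneg θ).trans_eq ?_
    simp only [dotProduct, Matrix.mulVec, Finset.mul_sum, Pi.star_apply, star_trivial]
    exact Finset.sum_congr rfl fun _ _ => Finset.sum_congr rfl fun _ _ => by ring
  refine posSemidef_of_forall (fun α β => ?_) fun θ => ?_
  · simp only [Matrix.of_apply]
    rw [← hq.isHermitian.apply α β]; simp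
  · have : ∑ α, ∑ β, θ α * θ β * (Cb + c * q α β) =
        Cb * (∑ α, θ α) ^ 2 + c * ∑ α, ∑ β, θ α * θ β * q α β := by
      rw [sq, Finset.sum_mul_sum]
      simp only [Finset.mul_sum, ← Finset.sum_add_distrib]
      exact Finset.sum_congr rfl fun _ _ => Finset.sum_congr rfl fun _ _ => by ring
    simp only [Matrix.of_apply, this]
    have := hq' θ
    positivity

/-- A Gram matrix is positive semidefinite. -/
theorem posSemidef_sum_mul (u : ι → A → ℝ) :
    (Matrix.of fun α β => ∑ k, u k α * u k β : Matrix A A ℝ).PosSemidef := by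
  refine posSemidef_of_forall (fun α β => by simp [mul_comm]) fun θ => ?_
  have := sum_mul_sq_eq (fun _ => 1) θ u
  simp only [one_mul] at this
  simp only [Matrix.of_apply, ← this]
  exact Finset.sum_nonneg fun _ _ => sq_nonneg _

variable [DecidableEq A]

/-- The centered Gaussian law with covariance matrix `q`, as the image of the standard Gaussian law
under `q^#`. -/
noncomputable def gaussLaw (q : Matrix A A ℝ) : Measure (A → ℝ) :=
  (Measure.pi fun _ : A => gaussianReal 0 1).map fun N α => ∑ γ, matSqrt q α γ * N γ

theorem gaussLaw_eq_map_linComb (q : Matrix A A ℝ) :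
    gaussLaw q = (Measure.pi fun _ : A => gaussianReal 0 1).map
      (linComb fun γ α => matSqrt q α γ) := by
  unfold gaussLaw
  congr 1
  ext N α
  simp [linComb, mul_comm]

instance isProbabilityMeasure_gaussLaw (q : Matrix A A ℝ) :
    IsProbabilityMeasure (gaussLaw q) := by
  rw [gaussLaw_eq_map_linComb]
  exact Measure.isProbabilityMeasure_map (continuous_linComb _).aemeasurable

theorem matSqrt_sum_mul {q : Matrix A A ℝ} (hq : q.PosSemidef) (α β : A) :
    ∑ γ, matSqrt q α γ * matSqrt q β γ = q α β := by
  conv_rhs => rw [← matSqrt_mul_self hq, Matrix.mul_apply]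
  refine Finset.sum_congr rfl fun γ _ => ?_
  rw [← congrFun (congrFun (matSqrt_transpose q) γ) β, Matrix.transpose_apply]

/-- A linear image of independent centered Gaussian variables has law `gaussLaw q`, with `q` its
covariance matrix. -/
theorem map_linComb_eq_gaussLaw (v : ι → ℝ≥0) (c : ι → A → ℝ) {q : Matrix A A ℝ}
    (hq : q.PosSemidef) (hqc : ∀ α β, q α β = ∑ i, (v i : ℝ) * (c i α * c i β)) :
    (Measure.pi fun i => gaussianReal 0 (v i)).map (linComb c) = gaussLaw q := by
  have : IsProbabilityMeasure ((Measure.pi fun i => gaussianReal 0 (v i)).map (linComb c)) :=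
    Measure.isProbabilityMeasure_map (continuous_linComb _).aemeasurable
  refine Measure.ext_of_charFunDual ?_
  ext ℓ
  rw [gaussLaw_eq_map_linComb, charFunDual_map_linComb, charFunDual_map_linComb]
  simp only [NNReal.coe_one, one_mul, matSqrt_sum_mul hq, hqc]

theorem lintegral_exp_gaussLaw {q : Matrix A A ℝ} (hq : q.PosSemidef) (θ : A → ℝ) :
    ∫⁻ y, ENNReal.ofReal (Real.exp (∑ α, θ α * y α)) ∂gaussLaw q =
      ENNReal.ofReal (Real.exp ((∑ α, ∑ β, θ α * θ β * q α β) / 2)) := by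
  have hmeas : Measurable fun y : A → ℝ => ENNReal.ofReal (Real.exp (∑ α, θ α * y α)) := by
    fun_prop
  rw [gaussLaw_eq_map_linComb, lintegral_map hmeas (continuous_linComb _).measurable]
  simp_rw [sum_mul_linComb, Real.exp_sum]
  simp_rw [ENNReal.ofReal_prod_of_nonneg fun i _ => Real.exp_nonneg _]
  rw [lintegral_pi_prod_eq_prod_lintegral _
    (f := fun γ (y : ℝ) => ENNReal.ofReal (Real.exp ((∑ α, θ α * matSqrt q α γ) * y)))
    (fun γ => by fun_prop)]
  have h1 : ∀ t : ℝ, ∫⁻ y, ENNReal.ofReal (Real.exp (t * y)) ∂gaussianReal 0 1 =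
      ENNReal.ofReal (Real.exp (1 * t ^ 2 / 2)) := by
    intro t
    rw [← ofReal_integral_eq_lintegral_ofReal (integrable_exp_mul_gaussianReal t)
      (Eventually.of_forall fun _ => Real.exp_nonneg _)]
    have := congrFun (mgf_fun_id_gaussianReal (μ := 0) (v := 1)) t
    rw [mgf] at this
    rw [this]
    simp
  simp_rw [h1]
  rw [← ENNReal.ofReal_prod_of_nonneg fun i _ => Real.exp_nonneg _, ← Real.exp_sum,
    ← Finset.sum_div, sum_mul_sq_eq (fun _ => 1)]
  simp only [one_mul, matSqrt_sum_mul hq]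

theorem yMat_eq_integral_gaussLaw {σ : ℝ → ℝ} (hσ : Continuous σ) (q : Matrix A A ℝ) (α β : A) :
    yMat σ q α β = ∫ y, σ (y α) * σ (y β) ∂gaussLaw q := by
  rw [gaussLaw_eq_map_linComb, integral_map (continuous_linComb _).aemeasurable (by fun_prop)]
  simp [yMat, linComb, mul_comm]

open scoped Matrix.Norms.L2Operator in
theorem continuousOn_matSqrt : ContinuousOn (matSqrt (A := A)) {q | q.PosSemidef} := by
  simp_rw [← Matrix.nonneg_iff_posSemidef]
  exact CFC.continuousOn_sqrt

theorem continuousOn_yMat {σ : ℝ → ℝ} (hσ : Continuous σ) {M : ℝ} (hM : ∀ t, |σ t| ≤ M)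
    (α β : A) : ContinuousOn (fun q : Matrix A A ℝ => yMat σ q α β) {q | q.PosSemidef} := by
  have : FirstCountableTopology (Matrix A A ℝ) :=
    inferInstanceAs (FirstCountableTopology (A → A → ℝ))
  intro q hq
  have hs : ∀ α γ : A, Tendsto (fun q => matSqrt q α γ) (𝓝[{q | q.PosSemidef}] q)
      (𝓝 (matSqrt q α γ)) := fun α γ =>
    tendsto_pi_nhds.1 (tendsto_pi_nhds.1 (continuousOn_matSqrt q hq) α) γ
  refine tendsto_integral_filter_of_dominated_convergence (fun _ => M * M) ?_ ?_ ?_ ?_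
  · refine Eventually.of_forall fun q' => ?_
    generalize matSqrt q' = s
    fun_prop
  · refine Eventually.of_forall fun q' => Eventually.of_forall fun N => ?_
    rw [Real.norm_eq_abs, abs_mul]
    exact mul_le_mul (hM _) (hM _) (abs_nonneg _) ((abs_nonneg _).trans (hM 0))
  · exact integrable_const _
  · refine Eventually.of_forall fun N => Tendsto.mul ?_ ?_
    all_goals
      refine (hσ.tendsto _).comp (tendsto_finsetSum _ fun γ _ => ?_)
      exact (hs _ γ).mul_const _

theorem posSemidef_yMat {σ : ℝ → ℝ} (hσ : Continuous σ) {M : ℝ} (hM : ∀ t, |σ t| ≤ M)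
    (q : Matrix A A ℝ) : (yMat σ q).PosSemidef := by
  have hint : ∀ α β, Integrable (fun y : A → ℝ => σ (y α) * σ (y β)) (gaussLaw q) := by
    intro α β
    refine Integrable.of_bound (by fun_prop) (M * M) (Eventually.of_forall fun N => ?_)
    rw [Real.norm_eq_abs, abs_mul]
    exact mul_le_mul (hM _) (hM _) (abs_nonneg _) ((abs_nonneg _).trans (hM 0))
  refine posSemidef_of_forall (fun α β => by simp [yMat, mul_comm]) fun θ => ?_
  simp_rw [yMat_eq_integral_gaussLaw hσ, ← integral_const_mul]
  have h1 : ∀ α, ∑ β, ∫ y, θ α * θ β * (σ (y α) * σ (y β)) ∂gaussLaw q =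
      ∫ y, ∑ β, θ α * θ β * (σ (y α) * σ (y β)) ∂gaussLaw q := fun α =>
    (integral_finsetSum _ fun β _ => (hint α β).const_mul _).symm
  simp_rw [h1]
  rw [← integral_finsetSum _ fun α _ => integrable_finsetSum _ fun β _ => (hint α β).const_mul _]
  refine integral_nonneg fun y => ?_
  have h2 : ∑ α, ∑ β, θ α * θ β * (σ (y α) * σ (y β)) = (∑ α, θ α * σ (y α)) ^ 2 := by
    rw [sq, Finset.sum_mul_sum]
    exact Finset.sum_congr rfl fun _ _ => Finset.sum_congr rfl fun _ _ => by ring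
  simp only [h2]
  exact sq_nonneg _

theorem posSemidef_limitCov {σ : ℝ → ℝ} (hσ : Continuous σ) {M : ℝ} (hM : ∀ t, |σ t| ≤ M)
    (Cb CW : ℝ≥0) {n₀ : ℕ} (x : A → Fin n₀ → ℝ) (ℓ : ℕ) :
    (limitCov σ Cb CW x ℓ).PosSemidef := by
  cases ℓ with
  | zero =>
    exact posSemidef_const_add_mul Cb.2 (div_nonneg CW.2 (Nat.cast_nonneg _))
      (posSemidef_sum_mul fun r α => x α r)
  | succ ℓ =>
    exact posSemidef_const_add_mul Cb.2 CW.2 (posSemidef_yMat hσ hM _)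

/-- Hoeffding's lemma for `σ (y α) * σ (y β)`, with a crude constant. -/
theorem lintegral_exp_mul_le {σ : ℝ → ℝ} (hσ : Continuous σ) {M : ℝ} (hM : ∀ t, |σ t| ≤ M)
    (q : Matrix A A ℝ) (α β : A) (t : ℝ) :
    ∫⁻ y, ENNReal.ofReal (Real.exp (t * (σ (y α) * σ (y β)))) ∂gaussLaw q ≤
      ENNReal.ofReal (Real.exp (t * yMat σ q α β + t ^ 2 * M ^ 4 / 2)) := by
  have hM0 : 0 ≤ M := (abs_nonneg _).trans (hM 0)
  have hsub := hasSubgaussianMGF_of_mem_Icc (μ := gaussLaw q) (a := -M ^ 2) (b := M ^ 2)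
    (X := fun y => σ (y α) * σ (y β)) (by fun_prop) (Eventually.of_forall fun y => by
      refine abs_le.1 ?_
      rw [abs_mul, sq]
      exact mul_le_mul (hM _) (hM _) (abs_nonneg _) hM0)
  have hint := hsub.integrable_exp_mul t
  have hle := hsub.mgf_le t
  rw [← yMat_eq_integral_gaussLaw hσ] at hint hle
  have hc : (((‖M ^ 2 - -M ^ 2‖₊ / 2) ^ 2 : ℝ≥0) : ℝ) = M ^ 4 := by
    have h : ‖M ^ 2 - -M ^ 2‖ = 2 * M ^ 2 := by
      rw [Real.norm_eq_abs, abs_of_nonneg (by linarith [sq_nonneg M])]; ring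
    push_cast
    rw [h]; ring
  rw [hc] at hle
  calc ∫⁻ y, ENNReal.ofReal (Real.exp (t * (σ (y α) * σ (y β)))) ∂gaussLaw q
      = ∫⁻ y, ENNReal.ofReal (Real.exp (t * yMat σ q α β)) *
          ENNReal.ofReal (Real.exp (t * (σ (y α) * σ (y β) - yMat σ q α β))) ∂gaussLaw q := by
        refine lintegral_congr fun y => ?_
        rw [ofReal_exp_mul_ofReal_exp]; ring_nf
    _ = ENNReal.ofReal (Real.exp (t * yMat σ q α β)) *
          ENNReal.ofReal (∫ y, Real.exp (t * (σ (y α) * σ (y β) - yMat σ q α β)) ∂gaussLaw q) := by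
        rw [lintegral_const_mul' _ _ ENNReal.ofReal_ne_top,
          ofReal_integral_eq_lintegral_ofReal hint
            (Eventually.of_forall fun _ => Real.exp_nonneg _)]
    _ ≤ ENNReal.ofReal (Real.exp (t * yMat σ q α β)) *
          ENNReal.ofReal (Real.exp (M ^ 4 * t ^ 2 / 2)) := by
        gcongr
        exact hle
    _ = _ := by rw [ofReal_exp_mul_ofReal_exp]; ring_nf

end GaussianVectors

/-! ### One layer of the network, conditionally on the previous ones -/

section Layer

variable {A κ ι : Type*} [Fintype κ] [Fintype ι]

/-- The matrix `C_b + c ∑ₖ uₖ uₖᵀ`: the covariance of a neuron, given the activations `u` of the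
previous layer, if the weights have variance `c`. -/
def layerCov (Cb c : ℝ≥0) (u : κ → A → ℝ) : Matrix A A ℝ :=
  Matrix.of fun α β => (Cb : ℝ) + (c : ℝ) * ∑ k, u k α * u k β

/-- The coefficients of the bias (`none`) and of the weights (`some k`) in the preactivation of a
neuron. -/
def paramCoeff (u : κ → A → ℝ) : Option κ → A → ℝ := fun o α => o.elim 1 fun k => u k α

/-- The variances of the bias and of the weights of a neuron. -/
def paramVar (Cb c : ℝ≥0) : Option κ → ℝ≥0 := fun o => o.elim Cb fun _ => c

theorem continuous_linComb_paramCoeff :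
    Continuous fun p : (κ → A → ℝ) × (Option κ → ℝ) => linComb (paramCoeff p.1) p.2 := by
  refine continuous_pi fun α => ?_
  simp only [linComb, Fintype.sum_option, paramCoeff, Option.elim]
  fun_prop

variable [Fintype A]

theorem posSemidef_layerCov (Cb c : ℝ≥0) (u : κ → A → ℝ) : (layerCov Cb c u).PosSemidef :=
  posSemidef_const_add_mul Cb.2 c.2 (posSemidef_sum_mul u)

variable [DecidableEq A]

theorem map_linComb_paramCoeff (Cb c : ℝ≥0) (u : κ → A → ℝ) :
    (Measure.pi fun o => gaussianReal 0 (paramVar Cb c o)).map (linComb (paramCoeff u)) =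
      gaussLaw (layerCov Cb c u) := by
  refine map_linComb_eq_gaussLaw _ _ (posSemidef_layerCov Cb c u) fun α β => ?_
  simp [layerCov, Fintype.sum_option, paramCoeff, paramVar, Finset.mul_sum]

/-- Given the activations `X` of a layer, the neurons of the next layer are independent centered
Gaussian vectors with covariance `layerCov Cb c X`. -/
theorem lintegral_layer {Ω : Type*} [MeasurableSpace Ω] {P : Measure Ω} [IsProbabilityMeasure P]
    (Cb c : ℝ≥0) {X : Ω → κ → A → ℝ} {Y : Ω → ι → Option κ → ℝ} (hX : Measurable X)
    (hY : Measurable Y) (hXY : IndepFun X Y P)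
    (hlaw : P.map Y =
      Measure.pi fun _ : ι => Measure.pi fun o => gaussianReal 0 (paramVar Cb c o))
    {ψ : (κ → A → ℝ) → ℝ≥0∞} (hψ : Measurable ψ) {φ : ι → (A → ℝ) → ℝ≥0∞}
    (hφ : ∀ i, Measurable (φ i)) :
    ∫⁻ ω, ψ (X ω) * ∏ i, φ i (linComb (paramCoeff (X ω)) (Y ω i)) ∂P =
      ∫⁻ ω, ψ (X ω) * ∏ i, ∫⁻ y, φ i y ∂gaussLaw (layerCov Cb c (X ω)) ∂P := by
  set F : (κ → A → ℝ) × (ι → Option κ → ℝ) → ℝ≥0∞ :=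
    fun p => ψ p.1 * ∏ i, φ i (linComb (paramCoeff p.1) (p.2 i))
  have hF : Measurable F := by
    refine (hψ.comp measurable_fst).mul (Finset.measurable_prod _ fun i _ => (hφ i).comp ?_)
    exact continuous_linComb_paramCoeff.measurable.comp
      (measurable_fst.prodMk ((measurable_pi_apply i).comp measurable_snd))
  have h1 : ∀ u, ∫⁻ y, F (u, y) ∂(P.map Y) =
      ψ u * ∏ i, ∫⁻ y, φ i y ∂gaussLaw (layerCov Cb c u) := by
    intro u
    have hl : Measurable (linComb (paramCoeff u)) := (continuous_linComb _).measurable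
    simp only [F]
    have hprod : Measurable fun y : ι → Option κ → ℝ => ∏ i, φ i (linComb (paramCoeff u) (y i)) :=
      Finset.measurable_prod _ fun i _ => (hφ i).comp (hl.comp (measurable_pi_apply i))
    rw [lintegral_const_mul _ hprod, hlaw]
    congr 1
    refine (lintegral_pi_prod_eq_prod_lintegral _
      (f := fun i y => φ i (linComb (paramCoeff u) y)) fun i => (hφ i).comp hl).trans ?_
    refine Finset.prod_congr rfl fun i _ => ?_
    rw [← map_linComb_paramCoeff, lintegral_map (hφ i) hl]
  calc ∫⁻ ω, F (X ω, Y ω) ∂P = ∫⁻ p, F p ∂(P.map fun ω => (X ω, Y ω)) :=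
        (lintegral_map hF (hX.prodMk hY)).symm
    _ = ∫⁻ u, ∫⁻ y, F (u, y) ∂(P.map Y) ∂(P.map X) := by
        rw [(indepFun_iff_map_prod_eq_prod_map_map hX.aemeasurable hY.aemeasurable).1 hXY,
          lintegral_prod _ hF.aemeasurable]
    _ = ∫⁻ ω, ∫⁻ y, F (X ω, y) ∂(P.map Y) ∂P := lintegral_map hF.lintegral_prod_right' hX
    _ = _ := lintegral_congr fun ω => h1 (X ω)

end Layer

/-! ### The layers of a Gaussian network -/

section Network

variable {A : Type*} {n₀ : ℕ}

/-- The activations: the input for `ℓ = 0`, the vectors `σ (Z_k^{(ℓ)}(x_α))_α` for `ℓ ≥ 1`. -/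
noncomputable def activation (σ : ℝ → ℝ) (w : ℕ → ℕ) (b : ℕ → ℕ → ℝ) (W : ℕ → ℕ → ℕ → ℝ)
    (x : A → Fin n₀ → ℝ) : ℕ → ℕ → A → ℝ
  | 0, k, α => if h : k < n₀ then x α ⟨k, h⟩ else 0
  | ℓ + 1, k, α => σ (preactivation σ w b W (x α) ℓ k)

theorem preactivation_eq (σ : ℝ → ℝ) {w : ℕ → ℕ} (hw : w 0 = n₀) (b : ℕ → ℕ → ℝ)
    (W : ℕ → ℕ → ℕ → ℝ) (x : A → Fin n₀ → ℝ) (ℓ i : ℕ) (α : A) :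
    preactivation σ w b W (x α) ℓ i =
      b (ℓ + 1) i + ∑ k : Fin (w ℓ), W (ℓ + 1) i k * activation σ w b W x ℓ k α := by
  cases ℓ with
  | zero => subst hw; simp [preactivation, activation]
  | succ ℓ =>
    rw [preactivation, Finset.sum_range]
    rfl

/-- Two families of parameters that agree on the parameters that occur in the network give the same
preactivations. -/
theorem preactivation_congr (σ : ℝ → ℝ) {w : ℕ → ℕ} (hw : w 0 = n₀) {b b' : ℕ → ℕ → ℝ}
    {W W' : ℕ → ℕ → ℕ → ℝ} {L : ℕ} (hb : ∀ ℓ ≤ L, ∀ i < w (ℓ + 1), b (ℓ + 1) i = b' (ℓ + 1) i)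
    (hW : ∀ ℓ ≤ L, ∀ i < w (ℓ + 1), ∀ j < w ℓ, W (ℓ + 1) i j = W' (ℓ + 1) i j)
    (x : Fin n₀ → ℝ) {ℓ : ℕ} (hℓ : ℓ ≤ L) {i : ℕ} (hi : i < w (ℓ + 1)) :
    preactivation σ w b W x ℓ i = preactivation σ w b' W' x ℓ i := by
  induction ℓ generalizing i with
  | zero =>
    simp only [preactivation]
    rw [hb 0 hℓ i hi]
    congr 1
    exact Finset.sum_congr rfl fun r _ => by rw [hW 0 hℓ i hi r (hw ▸ r.2)]
  | succ ℓ ih =>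
    simp only [preactivation]
    rw [hb (ℓ + 1) hℓ i hi]
    congr 1
    refine Finset.sum_congr rfl fun j hj => ?_
    rw [hW (ℓ + 1) hℓ i hi j (Finset.mem_range.1 hj), ih (by omega) (Finset.mem_range.1 hj)]

variable {Ω : Type*}

/-- The activations of layer `ℓ`, as a random element of `ℝ^{n_ℓ × |A|}`. -/
noncomputable def layerAct (σ : ℝ → ℝ) (w : ℕ → ℕ) (b : ℕ → ℕ → Ω → ℝ)
    (W : ℕ → ℕ → ℕ → Ω → ℝ) (x : A → Fin n₀ → ℝ) (ℓ : ℕ) (ω : Ω) : Fin (w ℓ) → A → ℝ :=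
  fun k α => activation σ w (fun ℓ i => b ℓ i ω) (fun ℓ i j => W ℓ i j ω) x ℓ k α

/-- The parameters of layer `ℓ + 1`, neuron by neuron. -/
def layerParam (w : ℕ → ℕ) (b : ℕ → ℕ → Ω → ℝ) (W : ℕ → ℕ → ℕ → Ω → ℝ) (ℓ : ℕ) (ω : Ω) :
    Fin (w (ℓ + 1)) → Option (Fin (w ℓ)) → ℝ :=
  fun i o => o.elim (b (ℓ + 1) i ω) fun k => W (ℓ + 1) i k ω

theorem preactivation_eq_linComb (σ : ℝ → ℝ) {w : ℕ → ℕ} (hw : w 0 = n₀)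
    (b : ℕ → ℕ → Ω → ℝ) (W : ℕ → ℕ → ℕ → Ω → ℝ) (x : A → Fin n₀ → ℝ) (ℓ : ℕ)
    (i : Fin (w (ℓ + 1))) (ω : Ω) :
    (fun α => preactivation σ w (fun ℓ i => b ℓ i ω) (fun ℓ i j => W ℓ i j ω) (x α) ℓ i) =
      linComb (paramCoeff (layerAct σ w b W x ℓ ω)) (layerParam w b W ℓ ω i) := by
  ext α
  rw [preactivation_eq σ hw]
  simp [linComb, Fintype.sum_option, paramCoeff, layerParam, layerAct]

/-- The layer of a parameter. -/
def paramLayer {L : ℕ} {w : ℕ → ℕ} : ParamIndex L w → ℕ :=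
  Sum.elim (fun k => k.1) (fun k => k.1)

/-- The position of the parameters of layer `ℓ + 1` among all the parameters. -/
def layerIndex {L : ℕ} (w : ℕ → ℕ) (ℓ : Fin (L + 1)) :
    Fin (w (ℓ + 1)) × Option (Fin (w ℓ)) → ParamIndex L w
  | (i, none) => Sum.inl ⟨ℓ, i⟩
  | (i, some k) => Sum.inr ⟨ℓ, (i, k)⟩

theorem injective_layerIndex {L : ℕ} (w : ℕ → ℕ) (ℓ : Fin (L + 1)) :
    Function.Injective (layerIndex w ℓ) := by
  rintro ⟨i, _ | k⟩ ⟨i', _ | k'⟩ h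
  · simpa [layerIndex] using Sum.inl.inj h
  · exact absurd h Sum.inl_ne_inr
  · exact absurd h Sum.inr_ne_inl
  · simpa [layerIndex] using Sum.inr.inj h

theorem paramLayer_layerIndex {L : ℕ} (w : ℕ → ℕ) (ℓ : Fin (L + 1))
    (p : Fin (w (ℓ + 1)) × Option (Fin (w ℓ))) : paramLayer (layerIndex w ℓ p) = ℓ := by
  rcases p with ⟨i, _ | k⟩ <;> rfl

theorem networkParam_layerIndex {L : ℕ} (w : ℕ → ℕ) (b : ℕ → ℕ → Ω → ℝ)
    (W : ℕ → ℕ → ℕ → Ω → ℝ) (ℓ : Fin (L + 1)) (i : Fin (w (ℓ + 1))) (o : Option (Fin (w ℓ)))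
    (ω : Ω) : networkParam L w b W (layerIndex w ℓ (i, o)) ω = layerParam w b W ℓ ω i o := by
  cases o <;> rfl

/-- The σ-algebra generated by the parameters whose layer is in `S`. -/
abbrev paramSigma (L : ℕ) (w : ℕ → ℕ) (b : ℕ → ℕ → Ω → ℝ) (W : ℕ → ℕ → ℕ → Ω → ℝ) (S : Set ℕ) :
    MeasurableSpace Ω :=
  ⨆ i ∈ {i : ParamIndex L w | paramLayer i ∈ S},
    MeasurableSpace.comap (networkParam L w b W i) inferInstance

theorem measurable_layerParam_paramSigma {L : ℕ} (w : ℕ → ℕ) (b : ℕ → ℕ → Ω → ℝ)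
    (W : ℕ → ℕ → ℕ → Ω → ℝ) {S : Set ℕ} {ℓ : ℕ} (hℓL : ℓ ≤ L) (hℓ : ℓ ∈ S) :
    Measurable[paramSigma L w b W S] (layerParam w b W ℓ) := by
  refine @measurable_pi_lambda _ _ _ (paramSigma L w b W S) _ _ fun i =>
    @measurable_pi_lambda _ _ _ (paramSigma L w b W S) _ _ fun o => ?_
  let ℓ' : Fin (L + 1) := ⟨ℓ, by omega⟩
  have h1 : (fun ω => layerParam w b W ℓ ω i o) = networkParam L w b W (layerIndex w ℓ' (i, o)) :=
    funext fun ω => (networkParam_layerIndex w b W ℓ' i o ω).symm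
  have hmem : layerIndex w ℓ' (i, o) ∈ {i : ParamIndex L w | paramLayer i ∈ S} := by
    change paramLayer (layerIndex w ℓ' (i, o)) ∈ S
    rw [paramLayer_layerIndex]; exact hℓ
  rw [h1, measurable_iff_comap_le]
  exact le_iSup₂_of_le (f := fun i (_ : i ∈ {i : ParamIndex L w | paramLayer i ∈ S}) =>
    MeasurableSpace.comap (networkParam L w b W i) inferInstance) _ hmem le_rfl

theorem measurable_layerAct_paramSigma [Fintype A] {σ : ℝ → ℝ} (hσ : Continuous σ) {L : ℕ}
    {w : ℕ → ℕ}
    (hw : w 0 = n₀) (b : ℕ → ℕ → Ω → ℝ) (W : ℕ → ℕ → ℕ → Ω → ℝ) (x : A → Fin n₀ → ℝ) {ℓ : ℕ}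
    (hℓ : ℓ ≤ L + 1) :
    Measurable[paramSigma L w b W (Set.Iio ℓ)] (layerAct σ w b W x ℓ) := by
  suffices H : ∀ s ≤ ℓ, Measurable[paramSigma L w b W (Set.Iio ℓ)] (layerAct σ w b W x s) from
    H ℓ le_rfl
  intro s hs
  induction s with
  | zero =>
    exact @measurable_const _ _ _ (paramSigma L w b W (Set.Iio ℓ))
      (fun (k : Fin (w 0)) (α : A) => if h : (k : ℕ) < n₀ then x α ⟨k, h⟩ else 0)
  | succ s ih =>
    refine @measurable_pi_lambda _ _ _ (paramSigma L w b W (Set.Iio ℓ)) _ _ fun k => ?_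
    have h1 : (fun ω => layerAct σ w b W x (s + 1) ω k) = fun ω => fun α =>
        σ (linComb (paramCoeff (layerAct σ w b W x s ω)) (layerParam w b W s ω k) α) := by
      ext ω α
      exact congrArg σ (congrFun (preactivation_eq_linComb σ hw b W x s k ω) α)
    rw [h1]
    have h2 : Continuous fun p : (Fin (w s) → A → ℝ) × (Option (Fin (w s)) → ℝ) =>
        fun α => σ (linComb (paramCoeff p.1) p.2 α) :=
      continuous_pi fun α => hσ.comp ((continuous_apply α).comp continuous_linComb_paramCoeff)
    refine h2.measurable.comp (Measurable.prodMk (ih (by omega)) ?_)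
    exact (measurable_pi_apply k).comp
      (measurable_layerParam_paramSigma w b W (by omega) (Set.mem_Iio.2 (by omega)))

variable [MeasurableSpace Ω]

/-- All the parameters are measurable functions (and not only almost everywhere measurable). -/
structure MeasurableParams (b : ℕ → ℕ → Ω → ℝ) (W : ℕ → ℕ → ℕ → Ω → ℝ) : Prop where
  bias : ∀ ℓ i, Measurable (b ℓ i)
  weight : ∀ ℓ i j, Measurable (W ℓ i j)

variable {P : Measure Ω} {L : ℕ} {w : ℕ → ℕ} {Cb CW : ℝ≥0} {b : ℕ → ℕ → Ω → ℝ}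
  {W : ℕ → ℕ → ℕ → Ω → ℝ}

theorem MeasurableParams.networkParam (hm : MeasurableParams b W) (i : ParamIndex L w) :
    Measurable (networkParam L w b W i) := by
  rcases i with ⟨ℓ, i⟩ | ⟨ℓ, i, k⟩
  · exact hm.bias _ _
  · exact hm.weight _ _ _

theorem MeasurableParams.paramSigma_le (hm : MeasurableParams b W) (S : Set ℕ) :
    paramSigma L w b W S ≤ ‹MeasurableSpace Ω› :=
  iSup₂_le fun i _ => (hm.networkParam i).comap_le

theorem MeasurableParams.layerParam (hm : MeasurableParams b W) (ℓ : ℕ) :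
    Measurable (layerParam w b W ℓ) := by
  refine measurable_pi_lambda _ fun i => measurable_pi_lambda _ fun o => ?_
  cases o with
  | none => exact hm.bias _ _
  | some k => exact hm.weight _ _ _

theorem MeasurableParams.layerAct [Fintype A] {σ : ℝ → ℝ} (hσ : Continuous σ)
    (hm : MeasurableParams b W)
    (hw : w 0 = n₀) (x : A → Fin n₀ → ℝ) (ℓ : ℕ) : Measurable (layerAct σ w b W x ℓ) :=
  (measurable_layerAct_paramSigma (L := ℓ) hσ hw b W x (by omega)).mono (hm.paramSigma_le _) le_rfl

theorem indepFun_layerAct_layerParam [Fintype A] {σ : ℝ → ℝ} (hσ : Continuous σ)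
    (hm : MeasurableParams b W)
    (hinit : IsGaussianInit P L w Cb CW b W) (hw : w 0 = n₀) (x : A → Fin n₀ → ℝ) {ℓ : ℕ}
    (hℓ : ℓ ≤ L) : IndepFun (layerAct σ w b W x ℓ) (layerParam w b W ℓ) P := by
  have hdisj : Disjoint {i : ParamIndex L w | paramLayer i ∈ Set.Iio ℓ}
      {i : ParamIndex L w | paramLayer i ∈ ({ℓ} : Set ℕ)} := by
    refine Set.disjoint_left.2 fun i hi hi' => ?_
    have h1 : paramLayer i < ℓ := hi
    have h2 : paramLayer i = ℓ := hi'
    omega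
  have hind := indep_iSup_of_disjoint (fun i => (hm.networkParam i).comap_le) hinit.indep hdisj
  refine (IndepFun_iff_Indep _ _ _).2 (indep_of_indep_of_le_left
    (indep_of_indep_of_le_right hind ?_) ?_)
  · exact (measurable_layerParam_paramSigma w b W hℓ (Set.mem_singleton ℓ)).comap_le
  · exact (measurable_layerAct_paramSigma hσ hw b W x (by omega)).comap_le

theorem map_layerParam (hm : MeasurableParams b W) (hinit : IsGaussianInit P L w Cb CW b W)
    {ℓ : ℕ} (hℓ : ℓ ≤ L) :
    P.map (layerParam w b W ℓ) = Measure.pi fun _ : Fin (w (ℓ + 1)) =>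
      Measure.pi fun o => gaussianReal 0 (paramVar Cb (CW / (w ℓ : ℝ≥0)) o) := by
  let ℓ' : Fin (L + 1) := ⟨ℓ, by omega⟩
  have h1 : iIndepFun (fun p => networkParam L w b W (layerIndex w ℓ' p)) P :=
    hinit.indep.precomp (injective_layerIndex w ℓ')
  have h2 := h1.map_fun_eq_infinitePi_map fun p => hm.networkParam _
  have h3 : ∀ p, P.map (networkParam L w b W (layerIndex w ℓ' p)) =
      gaussianReal 0 (paramVar Cb (CW / (w ℓ : ℝ≥0)) p.2) := by
    rintro ⟨i, _ | k⟩
    · exact (hinit.bias ℓ hℓ i i.2).map_eq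
    · exact (hinit.weight ℓ hℓ i i.2 k k.2).map_eq
  simp_rw [h3] at h2
  have h4 : layerParam w b W ℓ = MeasurableEquiv.curry _ _ ℝ ∘
      fun ω p => networkParam L w b W (layerIndex w ℓ' p) ω := by
    ext ω i o
    exact (networkParam_layerIndex w b W ℓ' i o ω).symm
  rw [h4, ← Measure.map_map (by fun_prop) (measurable_pi_lambda _ fun p => hm.networkParam _), h2]
  have h5 := Measure.infinitePi_map_curry (fun (_ : Fin (w (ℓ + 1))) (o : Option (Fin (w ℓ))) =>
    gaussianReal 0 (paramVar Cb (CW / (w ℓ : ℝ≥0)) o))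
  simp only [Measure.infinitePi_eq_pi] at h5 ⊢
  exact h5

/-- The conditional covariance, given the hidden layers up to `ℓ`, of the neurons of layer
`ℓ + 1`. -/
noncomputable def empCov (σ : ℝ → ℝ) (Cb CW : ℝ≥0) (w : ℕ → ℕ) (b : ℕ → ℕ → Ω → ℝ)
    (W : ℕ → ℕ → ℕ → Ω → ℝ) (x : A → Fin n₀ → ℝ) (ℓ : ℕ) (ω : Ω) : Matrix A A ℝ :=
  layerCov Cb (CW / (w ℓ : ℝ≥0)) (layerAct σ w b W x ℓ ω)

theorem MeasurableParams.empCov [Fintype A] {σ : ℝ → ℝ} (hσ : Continuous σ)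
    (hm : MeasurableParams b W) (hw : w 0 = n₀) (x : A → Fin n₀ → ℝ) (ℓ : ℕ) :
    Measurable fun ω => (fun α β => empCov σ Cb CW w b W x ℓ ω α β) := by
  have h1 : Measurable fun u : Fin (w ℓ) → A → ℝ => fun α β =>
      layerCov Cb (CW / (w ℓ : ℝ≥0)) u α β := by
    simp only [layerCov, Matrix.of_apply]
    fun_prop
  exact h1.comp (hm.layerAct hσ hw x ℓ)

/-- Given the hidden layers up to `ℓ`, the neurons of layer `ℓ + 1` are independent
centered Gaussian vectors with covariance `empCov`. -/
theorem lintegral_empCov_mul_prod [Fintype A] [DecidableEq A] [IsProbabilityMeasure P]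
    {σ : ℝ → ℝ} (hσ : Continuous σ)
    (hm : MeasurableParams b W) (hinit : IsGaussianInit P L w Cb CW b W) (hw : w 0 = n₀)
    (x : A → Fin n₀ → ℝ) {ℓ : ℕ} (hℓ : ℓ ≤ L) {ψ : (A → A → ℝ) → ℝ≥0∞} (hψ : Measurable ψ)
    {φ : Fin (w (ℓ + 1)) → (A → ℝ) → ℝ≥0∞} (hφ : ∀ i, Measurable (φ i)) :
    ∫⁻ ω, ψ (fun α β => empCov σ Cb CW w b W x ℓ ω α β) * ∏ i : Fin (w (ℓ + 1)), φ i (fun α =>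
        preactivation σ w (fun ℓ i => b ℓ i ω) (fun ℓ i j => W ℓ i j ω) (x α) ℓ i) ∂P =
      ∫⁻ ω, ψ (fun α β => empCov σ Cb CW w b W x ℓ ω α β) *
        ∏ i, ∫⁻ y, φ i y ∂gaussLaw (empCov σ Cb CW w b W x ℓ ω) ∂P := by
  simp_rw [preactivation_eq_linComb σ hw]
  refine lintegral_layer Cb (CW / (w ℓ : ℝ≥0)) (hm.layerAct hσ hw x ℓ) (hm.layerParam ℓ)
    (indepFun_layerAct_layerParam hσ hm hinit hw x hℓ) (map_layerParam hm hinit hℓ)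
    (ψ := fun u => ψ (fun α β => layerCov Cb (CW / (w ℓ : ℝ≥0)) u α β)) (hψ.comp ?_) hφ
  simp only [layerCov, Matrix.of_apply]
  fun_prop

end Network

/-! ### Concentration of the conditional covariances -/

section Concentration

variable {A : Type*}

/-- The entries of `q` are within `δ` of those of `g`. -/
def IsNear (g : Matrix A A ℝ) (δ : ℝ) (q : Matrix A A ℝ) : Prop :=
  ∀ α β, |q α β - g α β| < δ

variable [Fintype A]

theorem measurableSet_isNear (g : Matrix A A ℝ) (δ : ℝ) :
    MeasurableSet {u : A → A → ℝ | ∀ α β, |u α β - g α β| < δ} := by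
  simp only [Set.ofPred_forall]
  refine MeasurableSet.iInter fun α => MeasurableSet.iInter fun β => ?_
  exact measurableSet_lt (by fun_prop) (by fun_prop)

theorem exists_isNear_of_eventually {g : Matrix A A ℝ} {p : Matrix A A ℝ → Prop}
    {S : Set (Matrix A A ℝ)} (h : ∀ᶠ q in 𝓝[S] g, p q) :
    ∃ δ > 0, ∀ q ∈ S, IsNear g δ q → p q := by
  rw [eventually_nhdsWithin_iff] at h
  have h' : ∀ᶠ q in 𝓝 (show A → A → ℝ from g), (show A → A → ℝ from q) ∈ (S : Set (A → A → ℝ)) →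
      p q := h
  obtain ⟨δ, hδ, hball⟩ := Metric.eventually_nhds_iff.1 h'
  refine ⟨δ, hδ, fun q hq hnear => hball ?_ hq⟩
  exact (dist_pi_lt_iff hδ).2 fun α => (dist_pi_lt_iff hδ).2 fun β => hnear α β

variable [DecidableEq A]

/-- A uniform Chernoff bound: for covariance matrices `q` near `g`, the exponential moments of
`± (σ (y α) * σ (y β) - yMat σ g α β) - δ` under `gaussLaw q` are uniformly less than one, for a
suitable exponent `t`. -/
theorem exists_uniform_chernoff {σ : ℝ → ℝ} (hσ : Continuous σ) {M : ℝ} (hM : ∀ t, |σ t| ≤ M)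
    {g : Matrix A A ℝ} (hg : g.PosSemidef) {δ : ℝ} (hδ : 0 < δ) :
    ∃ δ' > 0, ∃ κ > 0, ∃ t > 0, ∀ q : Matrix A A ℝ, q.PosSemidef → IsNear g δ' q → ∀ α β, ∀ s : ℝ,
      s = 1 ∨ s = -1 → ∫⁻ y, ENNReal.ofReal (Real.exp
        (t * (s * (σ (y α) * σ (y β) - yMat σ g α β) - δ))) ∂gaussLaw q ≤
          ENNReal.ofReal (Real.exp (-κ)) := by
  -- a positive bound of `σ`, since `M` may vanish
  set K : ℝ := max M 1
  have hK : ∀ t, |σ t| ≤ K := fun t => (hM t).trans (le_max_left _ _)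
  have hK0 : 0 < K := lt_max_of_lt_right one_pos
  have hev : ∀ᶠ q in 𝓝[{q : Matrix A A ℝ | q.PosSemidef}] g, ∀ α β,
      |yMat σ q α β - yMat σ g α β| < δ / 2 := by
    rw [eventually_all]; intro α
    rw [eventually_all]; intro β
    exact (Metric.tendsto_nhds.1 (continuousOn_yMat hσ hM α β g hg)) (δ / 2) (by linarith)
  obtain ⟨δ', hδ', hnear⟩ := exists_isNear_of_eventually hev
  -- `t` minimizes `t ^ 2 * K ^ 4 / 2 - t * δ / 2`
  refine ⟨δ', hδ', δ ^ 2 / (8 * K ^ 4), by positivity, δ / (2 * K ^ 4), by positivity,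
    fun q hq hqn α β s hs => ?_⟩
  set t : ℝ := δ / (2 * K ^ 4)
  have ht : 0 < t := by positivity
  have hs2 : s ^ 2 = 1 := by rcases hs with rfl | rfl <;> norm_num
  have hsy : s * (yMat σ q α β - yMat σ g α β) ≤ δ / 2 := by
    have h1 := hnear q hq hqn α β
    rw [abs_lt] at h1
    rcases hs with rfl | rfl <;> linarith
  calc ∫⁻ y, ENNReal.ofReal (Real.exp
        (t * (s * (σ (y α) * σ (y β) - yMat σ g α β) - δ))) ∂gaussLaw q
      = ∫⁻ y, ENNReal.ofReal (Real.exp (t * (-(s * yMat σ g α β) - δ))) *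
          ENNReal.ofReal (Real.exp ((t * s) * (σ (y α) * σ (y β)))) ∂gaussLaw q := by
        refine lintegral_congr fun y => ?_
        rw [ofReal_exp_mul_ofReal_exp]; ring_nf
    _ ≤ ENNReal.ofReal (Real.exp (t * (-(s * yMat σ g α β) - δ))) *
          ENNReal.ofReal (Real.exp ((t * s) * yMat σ q α β + (t * s) ^ 2 * K ^ 4 / 2)) := by
        rw [lintegral_const_mul' _ _ ENNReal.ofReal_ne_top]
        gcongr
        exact lintegral_exp_mul_le hσ hK q α β (t * s)
    _ ≤ _ := by
        rw [ofReal_exp_mul_ofReal_exp]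
        refine ENNReal.ofReal_le_ofReal (Real.exp_le_exp.2 ?_)
        have h1 := mul_le_mul_of_nonneg_left hsy ht.le
        have h2 : (t * s) ^ 2 = t ^ 2 := by rw [mul_pow, hs2, mul_one]
        have h3 : t ^ 2 * K ^ 4 / 2 - t * δ / 2 = -(δ ^ 2 / (8 * K ^ 4)) := by
          simp only [t]; field_simp; ring
        rw [h2]
        linarith

variable {n₀ : ℕ} {Ω : Type*} [MeasurableSpace Ω] {P : Measure Ω} [IsProbabilityMeasure P] {L : ℕ}
  {w : ℕ → ℕ} {Cb CW : ℝ≥0} {b : ℕ → ℕ → Ω → ℝ} {W : ℕ → ℕ → ℕ → Ω → ℝ}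

/-- The deviation of one entry of `empCov` in one direction, on the event that the covariance of
the previous layer is close to its limit. -/
theorem measure_isNear_inter_deviation_le {σ : ℝ → ℝ} (hσ : Continuous σ)
    (hCW : 0 < CW) (hm : MeasurableParams b W)
    (hinit : IsGaussianInit P L w Cb CW b W) (hw : w 0 = n₀) (x : A → Fin n₀ → ℝ) {ℓ : ℕ}
    (hℓ : ℓ < L) (hpos : 0 < w (ℓ + 1)) {g : Matrix A A ℝ} {δ δ' κ t : ℝ} (ht : 0 < t) {α β : A}
    {s : ℝ} (hch : ∀ q : Matrix A A ℝ, q.PosSemidef → IsNear g δ' q → ∫⁻ y, ENNReal.ofReal (Real.exp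
        (t * (s * (σ (y α) * σ (y β) - yMat σ g α β) - δ))) ∂gaussLaw q ≤
          ENNReal.ofReal (Real.exp (-κ))) :
    P {ω | IsNear g δ' (empCov σ Cb CW w b W x ℓ ω) ∧ CW * δ ≤
        s * (empCov σ Cb CW w b W x (ℓ + 1) ω α β - (Cb + CW * yMat σ g α β))} ≤
      ENNReal.ofReal (Real.exp (-(κ * w (ℓ + 1)))) := by
  let N : Set (A → A → ℝ) := {u | ∀ α β, |u α β - g α β| < δ'}
  let ψ : (A → A → ℝ) → ℝ≥0∞ := N.indicator 1
  have hψ : Measurable ψ := measurable_one.indicator (measurableSet_isNear g δ')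
  let φ : (A → ℝ) → ℝ≥0∞ := fun y => ENNReal.ofReal (Real.exp
    (t * (s * (σ (y α) * σ (y β) - yMat σ g α β) - δ)))
  have hφ : Measurable φ := by fun_prop
  have hid := lintegral_empCov_mul_prod hσ hm hinit hw x hℓ.le hψ
    (φ := fun _ => φ) fun _ => hφ
  let Z : Ω → Fin (w (ℓ + 1)) → A → ℝ := fun ω i α =>
    preactivation σ w (fun ℓ i => b ℓ i ω) (fun ℓ i j => W ℓ i j ω) (x α) ℓ i
  have hZ : ∀ i, Measurable fun ω => Z ω i := fun i => by
    have h1 : (fun ω => Z ω i) = fun ω =>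
        linComb (paramCoeff (layerAct σ w b W x ℓ ω)) (layerParam w b W ℓ ω i) :=
      funext fun ω => preactivation_eq_linComb σ hw b W x ℓ i ω
    rw [h1]
    exact continuous_linComb_paramCoeff.measurable.comp
      ((hm.layerAct hσ hw x ℓ).prodMk ((measurable_pi_apply i).comp (hm.layerParam ℓ)))
  have hmeas : Measurable fun ω =>
      ψ (fun α β => empCov σ Cb CW w b W x ℓ ω α β) * ∏ i, φ (Z ω i) :=
    (hψ.comp (hm.empCov hσ hw x ℓ)).mul (Finset.measurable_prod _ fun i _ => hφ.comp (hZ i))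
  have hw0 : (0 : ℝ) < w (ℓ + 1) := by exact_mod_cast hpos
  calc _ ≤ ∫⁻ ω, ψ (fun α β => empCov σ Cb CW w b W x ℓ ω α β) * ∏ i, φ (Z ω i) ∂P := by
        refine meas_le_lintegral₀ hmeas.aemeasurable ?_
        rintro ω ⟨hnear, hdev⟩
        have h1 : ψ (fun α β => empCov σ Cb CW w b W x ℓ ω α β) = 1 :=
          Set.indicator_of_mem (s := N) hnear _
        rw [h1, one_mul]
        simp only [φ]
        rw [← ENNReal.ofReal_prod_of_nonneg fun i _ => Real.exp_nonneg _, ← Real.exp_sum,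
          ← ENNReal.ofReal_one]
        refine ENNReal.ofReal_le_ofReal (Real.one_le_exp ?_)
        have h2 : empCov σ Cb CW w b W x (ℓ + 1) ω α β =
            Cb + CW / w (ℓ + 1) * ∑ i, σ (Z ω i α) * σ (Z ω i β) := by
          simp [empCov, layerCov, layerAct, activation, Z]
        have h3 : ∑ i, t * (s * (σ (Z ω i α) * σ (Z ω i β) - yMat σ g α β) - δ) =
            t * (s * (∑ i, σ (Z ω i α) * σ (Z ω i β)) -
              w (ℓ + 1) * (s * yMat σ g α β + δ)) := by
          rw [← Finset.mul_sum, Finset.sum_sub_distrib, ← Finset.mul_sum, Finset.sum_sub_distrib]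
          simp only [Finset.sum_const, Finset.card_univ, Fintype.card_fin, nsmul_eq_mul]
          ring
        rw [h3]
        rw [h2] at hdev
        have hC : (0 : ℝ) < CW := hCW
        have h4 : (CW : ℝ) / w (ℓ + 1) * (s * (∑ i, σ (Z ω i α) * σ (Z ω i β)) -
            w (ℓ + 1) * (s * yMat σ g α β + δ)) = s * (Cb + CW / w (ℓ + 1) *
              ∑ i, σ (Z ω i α) * σ (Z ω i β) - (Cb + CW * yMat σ g α β)) - CW * δ := by
          field_simp; ring
        have h5 := nonneg_of_mul_nonneg_right (h4 ▸ sub_nonneg.2 hdev) (div_pos hC hw0)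
        positivity
    _ = ∫⁻ ω, ψ (fun α β => empCov σ Cb CW w b W x ℓ ω α β) *
          ∏ _i : Fin (w (ℓ + 1)), ∫⁻ y, φ y ∂gaussLaw (empCov σ Cb CW w b W x ℓ ω) ∂P := hid
    _ ≤ ∫⁻ _, ENNReal.ofReal (Real.exp (-(κ * w (ℓ + 1)))) ∂P := by
        refine lintegral_mono fun ω => ?_
        by_cases hnear : IsNear g δ' (empCov σ Cb CW w b W x ℓ ω)
        · have h1 : ψ (fun α β => empCov σ Cb CW w b W x ℓ ω α β) = 1 :=
            Set.indicator_of_mem (s := N) hnear _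
          rw [h1, one_mul]
          refine (Finset.prod_le_prod' fun i _ =>
            hch _ (posSemidef_layerCov _ _ _) hnear).trans_eq ?_
          rw [Finset.prod_const, Finset.card_univ, Fintype.card_fin,
            ← ENNReal.ofReal_pow (Real.exp_nonneg _), ← Real.exp_nat_mul]
          ring_nf
        · have h1 : ψ (fun α β => empCov σ Cb CW w b W x ℓ ω α β) = 0 :=
            Set.indicator_of_notMem (s := N) hnear _
          rw [h1, zero_mul]
          exact zero_le
    _ = _ := by simp

theorem measure_not_isNear_succ_le {σ : ℝ → ℝ} (hσ : Continuous σ)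
    (hCW : 0 < CW) (hm : MeasurableParams b W)
    (hinit : IsGaussianInit P L w Cb CW b W) (hw : w 0 = n₀) (x : A → Fin n₀ → ℝ) {ℓ : ℕ}
    (hℓ : ℓ < L) (hpos : 0 < w (ℓ + 1)) {g : Matrix A A ℝ} {δ δ' κ t : ℝ} (ht : 0 < t)
    (hch : ∀ q : Matrix A A ℝ, q.PosSemidef → IsNear g δ' q → ∀ α β, ∀ s : ℝ, s = 1 ∨ s = -1 →
      ∫⁻ y, ENNReal.ofReal (Real.exp
        (t * (s * (σ (y α) * σ (y β) - yMat σ g α β) - δ))) ∂gaussLaw q ≤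
          ENNReal.ofReal (Real.exp (-κ))) :
    P {ω | ¬ IsNear (Matrix.of fun α β => (Cb : ℝ) + CW * yMat σ g α β) (CW * δ)
        (empCov σ Cb CW w b W x (ℓ + 1) ω)} ≤
      P {ω | ¬ IsNear g δ' (empCov σ Cb CW w b W x ℓ ω)} +
        (Fintype.card ((A × A) × Bool) : ℝ≥0∞) *
          ENNReal.ofReal (Real.exp (-(κ * w (ℓ + 1)))) := by
  let s : Bool → ℝ := fun c => if c then 1 else -1
  let B : (A × A) × Bool → Set Ω := fun p => {ω | IsNear g δ' (empCov σ Cb CW w b W x ℓ ω) ∧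
    CW * δ ≤ s p.2 * (empCov σ Cb CW w b W x (ℓ + 1) ω p.1.1 p.1.2 -
      (Cb + CW * yMat σ g p.1.1 p.1.2))}
  have hsub : {ω | ¬ IsNear (Matrix.of fun α β => (Cb : ℝ) + CW * yMat σ g α β) (CW * δ)
        (empCov σ Cb CW w b W x (ℓ + 1) ω)} ⊆
      {ω | ¬ IsNear g δ' (empCov σ Cb CW w b W x ℓ ω)} ∪ ⋃ p, B p := by
    intro ω hω
    by_cases hnear : IsNear g δ' (empCov σ Cb CW w b W x ℓ ω)
    · right
      have hω' : ¬ IsNear (Matrix.of fun α β => (Cb : ℝ) + CW * yMat σ g α β) (CW * δ)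
        (empCov σ Cb CW w b W x (ℓ + 1) ω) := hω
      simp only [IsNear, not_forall, not_lt, Matrix.of_apply] at hω'
      obtain ⟨α, β, hαβ⟩ := hω'
      rcases le_abs.1 hαβ with h | h
      · exact Set.mem_iUnion.2 ⟨((α, β), true), hnear, by simpa [s] using h⟩
      · exact Set.mem_iUnion.2 ⟨((α, β), false), hnear, by simpa [s] using h⟩
    · exact Or.inl hnear
  refine (measure_mono hsub).trans ((measure_union_le _ _).trans ?_)
  gcongr
  refine (measure_iUnion_fintype_le _ _).trans ((Finset.sum_le_sum fun p _ =>
    measure_isNear_inter_deviation_le hσ hCW hm hinit hw x hℓ hpos ht (κ := κ) fun q hq hqn =>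
      hch q hq hqn p.1.1 p.1.2 (s p.2) ?_).trans_eq ?_)
  · cases p.2 <;> simp [s]
  · rw [Finset.sum_const, nsmul_eq_mul, Finset.card_univ]

end Concentration

section Sequences

variable {A : Type*} {n₀ : ℕ}

theorem isNear_zero_empCov {σ : ℝ → ℝ} {M : ℝ} (hM : ∀ t, |σ t| ≤ M) {w : ℕ → ℕ} {Cb CW : ℝ≥0}
    {Ω : Type*} (b : ℕ → ℕ → Ω → ℝ) (W : ℕ → ℕ → ℕ → Ω → ℝ) (x : A → Fin n₀ → ℝ) (ℓ : ℕ)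
    (hpos : 0 < w (ℓ + 1)) (ω : Ω) :
    IsNear 0 (Cb + CW * M ^ 2 + 1) (empCov σ Cb CW w b W x (ℓ + 1) ω) := by
  intro α β
  have hw0 : (0 : ℝ) < w (ℓ + 1) := by exact_mod_cast hpos
  have hM0 : 0 ≤ M := (abs_nonneg _).trans (hM 0)
  have h1 : |∑ k, layerAct σ w b W x (ℓ + 1) ω k α * layerAct σ w b W x (ℓ + 1) ω k β| ≤
      w (ℓ + 1) * M ^ 2 := by
    refine (Finset.abs_sum_le_sum_abs _ _).trans ?_
    refine (Finset.sum_le_card_nsmul _ _ (M ^ 2) fun k _ => ?_).trans_eq (by simp)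
    rw [abs_mul, sq]
    exact mul_le_mul (hM _) (hM _) (abs_nonneg _) hM0
  have h2 : empCov σ Cb CW w b W x (ℓ + 1) ω α β = Cb + CW / w (ℓ + 1) *
      ∑ k, layerAct σ w b W x (ℓ + 1) ω k α * layerAct σ w b W x (ℓ + 1) ω k β := by
    simp [empCov, layerCov]
  rw [h2, Matrix.zero_apply, sub_zero]
  refine lt_of_le_of_lt ?_ (lt_add_one _)
  refine (abs_add_le _ _).trans ?_
  rw [abs_of_nonneg Cb.coe_nonneg, abs_mul,
    abs_of_nonneg (div_nonneg CW.coe_nonneg hw0.le)]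
  refine add_le_add le_rfl ?_
  calc (CW : ℝ) / w (ℓ + 1) * _ ≤ CW / w (ℓ + 1) * (w (ℓ + 1) * M ^ 2) := by gcongr
    _ = CW * M ^ 2 := by field_simp

variable [Fintype A]

theorem logLaplace_eq_sum {m : ℕ} (q : Matrix A A ℝ) (θ : A → Fin m → ℝ) :
    logLaplace q θ = ∑ h, (∑ α, ∑ β, θ α h * θ β h * q α β) / 2 := by
  rw [logLaplace, ← Finset.sum_div]
  congr 1
  conv_rhs => rw [Finset.sum_comm]
  refine Finset.sum_congr rfl fun α _ => ?_
  conv_rhs => rw [Finset.sum_comm]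
  simp only [Finset.mul_sum]
  exact Finset.sum_congr rfl fun _ _ => Finset.sum_congr rfl fun _ _ => by ring

theorem abs_logLaplace_sub_le {m : ℕ} {g q : Matrix A A ℝ} {δ : ℝ} (h : IsNear g δ q)
    (θ : A → Fin m → ℝ) :
    |logLaplace q θ - logLaplace g θ| ≤ δ * ∑ α, ∑ β, |∑ h, θ α h * θ β h| := by
  have h1 : logLaplace q θ - logLaplace g θ =
      (∑ α, ∑ β, (q α β - g α β) * ∑ h, θ α h * θ β h) / 2 := by
    simp only [logLaplace, sub_mul, Finset.sum_sub_distrib]; ring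
  have h2 : |∑ α, ∑ β, (q α β - g α β) * ∑ h, θ α h * θ β h| ≤
      δ * ∑ α, ∑ β, |∑ h, θ α h * θ β h| := by
    rw [Finset.mul_sum]
    refine (Finset.abs_sum_le_sum_abs _ _).trans (Finset.sum_le_sum fun α _ => ?_)
    rw [Finset.mul_sum]
    refine (Finset.abs_sum_le_sum_abs _ _).trans (Finset.sum_le_sum fun β _ => ?_)
    rw [abs_mul]
    gcongr
    exact (h α β).le
  rw [h1, abs_div, abs_of_pos (by norm_num : (0 : ℝ) < 2)]
  linarith [abs_nonneg (∑ α, ∑ β, (q α β - g α β) * ∑ h, θ α h * θ β h)]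

variable [DecidableEq A]

/-- If the speed `v` is negligible compared with all the widths, then the conditional covariances
converge to `limitCov` faster than exponentially at speed `v`. -/
theorem measure_not_isNear_limitCov_le {σ : ℝ → ℝ} (hσ : Continuous σ) {M : ℝ}
    (hM : ∀ t, |σ t| ≤ M) {L : ℕ} {Cb CW : ℝ≥0} (hCW : 0 < CW) (x : A → Fin n₀ → ℝ)
    {w : ℕ → ℕ → ℕ} (hw : ∀ n, w n 0 = n₀) (hpos : ∀ n, ∀ ℓ ∈ Finset.Icc 1 L, 0 < w n ℓ)
    {Ω : ℕ → Type*} [∀ n, MeasurableSpace (Ω n)] {P : ∀ n, Measure (Ω n)}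
    [∀ n, IsProbabilityMeasure (P n)] {b : ∀ n, ℕ → ℕ → Ω n → ℝ} {W : ∀ n, ℕ → ℕ → ℕ → Ω n → ℝ}
    (hm : ∀ n, MeasurableParams (b n) (W n))
    (hinit : ∀ n, IsGaussianInit (P n) L (w n) Cb CW (b n) (W n)) {v : ℕ → ℝ} (hv : IsSpeed v)
    (hvw : ∀ ℓ ∈ Finset.Icc 1 L, Tendsto (fun n => (w n ℓ : ℝ) / v n) atTop atTop)
    {ℓ : ℕ} (hℓ : ℓ ≤ L) {δ : ℝ} (hδ : 0 < δ) (R : ℝ) :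
    ∀ᶠ n in atTop, P n {ω | ¬ IsNear (limitCov σ Cb CW x ℓ) δ
      (empCov σ Cb CW (w n) (b n) (W n) x ℓ ω)} ≤ ENNReal.ofReal (Real.exp (v n * -R)) := by
  induction ℓ generalizing δ R with
  | zero =>
    refine Eventually.of_forall fun n => ?_
    have h1 : ∀ ω, empCov σ Cb CW (w n) (b n) (W n) x 0 ω = limitCov σ Cb CW x 0 := by
      intro ω
      have hn := hw n
      ext α β
      subst hn
      simp [empCov, layerCov, layerAct, activation, limitCov]
    simp [h1, IsNear, hδ]
  | succ ℓ ih =>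
    have hCW' : (0 : ℝ) < CW := hCW
    obtain ⟨δ', hδ', κ, hκ, t, ht, hch⟩ := exists_uniform_chernoff hσ hM
      (posSemidef_limitCov hσ hM Cb CW x ℓ) (div_pos hδ hCW')
    have hmem : ℓ + 1 ∈ Finset.Icc 1 L := Finset.mem_Icc.2 ⟨by omega, hℓ⟩
    filter_upwards [ih (by omega) hδ' (R + 1),
      (hvw (ℓ + 1) hmem).eventually_ge_atTop ((R + 1) / κ),
      eventually_natCast_mul_exp_le hv (1 + Fintype.card ((A × A) × Bool))
        (by linarith : -(R + 1) < -R)] with n h1 h2 h3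
    have h4 := measure_not_isNear_succ_le hσ hCW (hm n) (hinit n) (hw n) x (by omega)
      (hpos n _ hmem) ht hch
    rw [mul_div_cancel₀ _ hCW'.ne'] at h4
    refine h4.trans (le_trans ?_ h3)
    rw [Nat.cast_add, Nat.cast_one, add_mul, one_mul]
    gcongr
    rw [div_le_div_iff₀ hκ (hv.1 n)] at h2
    linarith

/-! ### The Laplace transform of the output -/

/-- Given the hidden layers, the output is Gaussian with covariance `empCov`. -/
theorem lintegral_exp_pairing_networkOutput {σ : ℝ → ℝ} (hσ : Continuous σ) {L m : ℕ}
    {w : ℕ → ℕ} {Cb CW : ℝ≥0} {Ω : Type*} [MeasurableSpace Ω] {P : Measure Ω}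
    [IsProbabilityMeasure P] {b : ℕ → ℕ → Ω → ℝ} {W : ℕ → ℕ → ℕ → Ω → ℝ}
    (hm : MeasurableParams b W) (hinit : IsGaussianInit P L w Cb CW b W) (hw : w 0 = n₀)
    (hout : w (L + 1) = m) (x : A → Fin n₀ → ℝ) (θ : A → Fin m → ℝ) :
    ∫⁻ ω, ENNReal.ofReal (Real.exp (pairing θ (networkOutput σ L m w b W x ω))) ∂P =
      ∫⁻ ω, ENNReal.ofReal (Real.exp (logLaplace (empCov σ Cb CW w b W x L ω) θ)) ∂P := by
  subst hout
  have hid := lintegral_empCov_mul_prod hσ hm hinit hw x le_rfl (ψ := 1) measurable_one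
    (φ := fun h y => ENNReal.ofReal (Real.exp (∑ α, θ α h * y α))) fun h => by fun_prop
  simp only [Pi.one_apply, one_mul] at hid
  refine Eq.trans (lintegral_congr fun ω => ?_) (hid.trans (lintegral_congr fun ω => ?_))
  · rw [← ENNReal.ofReal_prod_of_nonneg fun _ _ => Real.exp_nonneg _, ← Real.exp_sum,
      Finset.sum_comm]
    rfl
  · rw [Finset.prod_congr rfl fun h _ => lintegral_exp_gaussLaw
        (q := empCov σ Cb CW w b W x L ω) (posSemidef_layerCov _ _ _) fun α => θ α h,
      ← ENNReal.ofReal_prod_of_nonneg fun _ _ => Real.exp_nonneg _, ← Real.exp_sum,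
      logLaplace_eq_sum]

theorem hasLaplaceLimit_networkOutput {σ : ℝ → ℝ} (hσ : Continuous σ) {M : ℝ}
    (hM : ∀ t, |σ t| ≤ M) {L : ℕ} (hL : 1 ≤ L) {m : ℕ} {Cb CW : ℝ≥0} (hCW : 0 < CW)
    (x : A → Fin n₀ → ℝ)
    {w : ℕ → ℕ → ℕ} (hw : ∀ n, w n 0 = n₀) (hout : ∀ n, w n (L + 1) = m)
    (hpos : ∀ n, ∀ ℓ ∈ Finset.Icc 1 L, 0 < w n ℓ)
    {Ω : ℕ → Type*} [∀ n, MeasurableSpace (Ω n)] {P : ∀ n, Measure (Ω n)}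
    [∀ n, IsProbabilityMeasure (P n)] {b : ∀ n, ℕ → ℕ → Ω n → ℝ} {W : ∀ n, ℕ → ℕ → ℕ → Ω n → ℝ}
    (hm : ∀ n, MeasurableParams (b n) (W n))
    (hinit : ∀ n, IsGaussianInit (P n) L (w n) Cb CW (b n) (W n)) {a : ℕ → ℝ}
    (ha : ∀ n, 0 < a n) (hv : IsSpeed fun n => 1 / a n)
    (hvw : ∀ ℓ ∈ Finset.Icc 1 L, Tendsto (fun n => (w n ℓ : ℝ) / (1 / a n)) atTop atTop)
    (hmeas : ∀ n, AEMeasurable (networkOutput σ L m (w n) (b n) (W n) x) (P n)) :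
    HasLaplaceLimit
      (fun n => (P n).map fun ω => Real.sqrt (a n) • networkOutput σ L m (w n) (b n) (W n) x ω)
      (fun n => 1 / a n) (limitCov σ Cb CW x L) := by
  intro θ ε hε
  set v : ℕ → ℝ := fun n => 1 / a n
  set g := limitCov σ Cb CW x L
  let G : ∀ n, Ω n → Matrix A A ℝ := fun n => empCov σ Cb CW (w n) (b n) (W n) x L
  have hlap : ∀ n, ∫⁻ y, ENNReal.ofReal (Real.exp (v n * pairing θ y)) ∂((P n).map fun ω =>
      Real.sqrt (a n) • networkOutput σ L m (w n) (b n) (W n) x ω) =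
      ∫⁻ ω, ENNReal.ofReal (Real.exp (v n * logLaplace (G n ω) θ)) ∂P n := by
    intro n
    have hs : Real.sqrt (a n) ≠ 0 := (Real.sqrt_pos.2 (ha n)).ne'
    have hs2 := Real.sq_sqrt (ha n).le
    have hsm : AEMeasurable
        (fun ω => Real.sqrt (a n) • networkOutput σ L m (w n) (b n) (W n) x ω) (P n) :=
      (hmeas n).const_smul (Real.sqrt (a n))
    rw [lintegral_map' (measurable_expPairing _ _).aemeasurable hsm]
    have h1 := lintegral_exp_pairing_networkOutput hσ (hm n) (hinit n) (hw n) (hout n) x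
      ((1 / Real.sqrt (a n)) • θ)
    have h2 : v n = (1 / Real.sqrt (a n)) ^ 2 := by
      simp only [v]; rw [div_pow, one_pow, hs2]
    simp only [logLaplace_smul, pairing_smul_left, ← h2] at h1
    rw [← h1]
    refine lintegral_congr fun ω => ?_
    congr 2
    have h3 : pairing θ (Real.sqrt (a n) • networkOutput σ L m (w n) (b n) (W n) x ω) =
        Real.sqrt (a n) * pairing θ (networkOutput σ L m (w n) (b n) (W n) x ω) := by
      simp only [pairing, Finset.mul_sum, Pi.smul_apply, smul_eq_mul]
      exact Finset.sum_congr rfl fun _ _ => Finset.sum_congr rfl fun _ _ => by ring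
    rw [h3, h2]
    field_simp
  simp_rw [hlap]
  set N : ℝ := ∑ α, ∑ β, |∑ h, θ α h * θ β h|
  have hN : 0 ≤ N := Finset.sum_nonneg fun _ _ => Finset.sum_nonneg fun _ _ => abs_nonneg _
  set δ : ℝ := ε / (2 * (N + 1))
  have hδ : 0 < δ := by positivity
  have hδN : δ * N ≤ ε / 2 := by
    calc δ * N ≤ δ * (N + 1) := by gcongr; linarith
      _ = ε / 2 := by simp only [δ]; field_simp
  set B : ℝ := (Cb + CW * M ^ 2 + 1) * N
  obtain ⟨L', rfl⟩ : ∃ L', L = L' + 1 := ⟨L - 1, by omega⟩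
  have hB : ∀ n ω, logLaplace (G n ω) θ ≤ B := by
    intro n ω
    have h1 := abs_logLaplace_sub_le (isNear_zero_empCov (Cb := Cb) (CW := CW) hM (b n) (W n) x L'
      (hpos n _ (Finset.mem_Icc.2 ⟨hL, le_rfl⟩)) ω) θ
    have h2 : logLaplace (0 : Matrix A A ℝ) θ = 0 := by simp [logLaplace]
    rw [h2, sub_zero] at h1
    exact (le_abs_self _).trans h1
  -- `R` makes up for the largest possible value `B` of the exponent
  set R : ℝ := max 1 (B - logLaplace g θ)
  have hR1 : 1 ≤ R := le_max_left _ _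
  have hRB : B - logLaplace g θ ≤ R := le_max_right _ _
  filter_upwards [measure_not_isNear_limitCov_le hσ hM hCW x hw hpos hm hinit hv hvw le_rfl hδ R,
    eventually_natCast_mul_exp_le hv 2
      (by linarith : logLaplace g θ + ε / 2 < logLaplace g θ + ε),
    eventually_natCast_mul_exp_le hv 2
      (by linarith : logLaplace g θ - ε < logLaplace g θ - ε / 2),
    eventually_natCast_mul_exp_le hv 2 (by linarith : -R < 0)] with n hfar hup hlow hhalf
  have hv0 : 0 ≤ v n := (hv.1 n).le
  set S : Set (Ω n) := {ω | IsNear g δ (G n ω)}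
  have hS : MeasurableSet S :=
    (hm n).empCov hσ (hw n) x (L' + 1) (measurableSet_isNear g δ)
  have hSc : P n Sᶜ ≤ ENNReal.ofReal (Real.exp (v n * -R)) := hfar
  have hnear : ∀ ω ∈ S, |logLaplace (G n ω) θ - logLaplace g θ| ≤ ε / 2 := fun ω hω =>
    (abs_logLaplace_sub_le hω θ).trans hδN
  constructor
  · have hPS : 1 ≤ 2 * P n S := by
      have h1 : 1 ≤ P n S + P n Sᶜ := by rw [measure_add_measure_compl hS, measure_univ]
      have h2 : 2 * P n Sᶜ ≤ 1 := by
        calc 2 * P n Sᶜ ≤ 2 * ENNReal.ofReal (Real.exp (v n * -R)) := by gcongr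
          _ ≤ ENNReal.ofReal (Real.exp (v n * 0)) := by exact_mod_cast hhalf
          _ = 1 := by simp
      have h3 : 1 + 1 ≤ 2 * P n S + 1 := by
        calc (1 : ℝ≥0∞) + 1 = 2 * 1 := by norm_num
          _ ≤ 2 * (P n S + P n Sᶜ) := by gcongr
          _ = 2 * P n S + 2 * P n Sᶜ := mul_add _ _ _
          _ ≤ _ := by gcongr
      exact (ENNReal.add_le_add_iff_right ENNReal.one_ne_top).1 h3
    refine (ENNReal.mul_le_mul_iff_right (a := 2) (by simp) (by simp)).1 ?_
    calc 2 * ENNReal.ofReal (Real.exp (v n * (logLaplace g θ - ε)))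
        ≤ ENNReal.ofReal (Real.exp (v n * (logLaplace g θ - ε / 2))) := by exact_mod_cast hlow
      _ ≤ ENNReal.ofReal (Real.exp (v n * (logLaplace g θ - ε / 2))) * (2 * P n S) :=
          le_mul_of_one_le_right' hPS
      _ = 2 * (ENNReal.ofReal (Real.exp (v n * (logLaplace g θ - ε / 2))) * P n S) := by ring
      _ ≤ 2 * ∫⁻ ω, ENNReal.ofReal (Real.exp (v n * logLaplace (G n ω) θ)) ∂P n := by
          gcongr
          rw [← setLIntegral_const]
          refine (setLIntegral_mono' hS fun ω hω => ?_).trans (setLIntegral_le_lintegral S _)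
          have h1 := abs_le.1 (hnear ω hω)
          gcongr
          linarith
  · calc ∫⁻ ω, ENNReal.ofReal (Real.exp (v n * logLaplace (G n ω) θ)) ∂P n
        = ∫⁻ ω in S, ENNReal.ofReal (Real.exp (v n * logLaplace (G n ω) θ)) ∂P n +
            ∫⁻ ω in Sᶜ, ENNReal.ofReal (Real.exp (v n * logLaplace (G n ω) θ)) ∂P n :=
          (lintegral_add_compl _ hS).symm
      _ ≤ ENNReal.ofReal (Real.exp (v n * (logLaplace g θ + ε / 2))) * P n S +
            ENNReal.ofReal (Real.exp (v n * B)) * P n Sᶜ := by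
          rw [← setLIntegral_const, ← setLIntegral_const]
          refine add_le_add (setLIntegral_mono' hS fun ω hω => ?_)
            (lintegral_mono fun ω => ?_)
          · have h1 := abs_le.1 (hnear ω hω)
            gcongr
            linarith
          · have h1 := hB n ω
            gcongr
      _ ≤ ENNReal.ofReal (Real.exp (v n * (logLaplace g θ + ε / 2))) * 1 +
            ENNReal.ofReal (Real.exp (v n * B)) * ENNReal.ofReal (Real.exp (v n * -R)) := by
          gcongr
          exact prob_le_one
      _ ≤ ENNReal.ofReal (Real.exp (v n * (logLaplace g θ + ε / 2))) +
            ENNReal.ofReal (Real.exp (v n * (logLaplace g θ + ε / 2))) := by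
          rw [mul_one, ofReal_exp_mul_ofReal_exp, ← mul_add]
          refine add_le_add le_rfl (ENNReal.ofReal_le_ofReal (Real.exp_le_exp.2
            (mul_le_mul_of_nonneg_left ?_ hv0)))
          linarith
      _ = 2 * ENNReal.ofReal (Real.exp (v n * (logLaplace g θ + ε / 2))) := (two_mul _).symm
      _ ≤ _ := by exact_mod_cast hup

end Sequences

/-! ### Measurable versions of the parameters and the moderate deviation principle -/

section Measurability

variable {Ω : Type*} [MeasurableSpace Ω]

open Classical in
/-- A measurable version of `f`, if `f` is almost everywhere measurable, and `0` otherwise. -/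
noncomputable def measVersion (P : Measure Ω) (f : Ω → ℝ) : Ω → ℝ :=
  if h : AEMeasurable f P then h.mk f else 0

theorem measurable_measVersion (P : Measure Ω) (f : Ω → ℝ) : Measurable (measVersion P f) := by
  unfold measVersion
  split_ifs with h
  · exact h.measurable_mk
  · exact measurable_zero

theorem ae_eq_measVersion {P : Measure Ω} {f : Ω → ℝ} (h : AEMeasurable f P) :
    f =ᵐ[P] measVersion P f := by
  unfold measVersion
  rw [dif_pos h]
  exact h.ae_eq_mk

theorem measurableParams_measVersion (P : Measure Ω) (b : ℕ → ℕ → Ω → ℝ)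
    (W : ℕ → ℕ → ℕ → Ω → ℝ) :
    MeasurableParams (fun ℓ i => measVersion P (b ℓ i)) fun ℓ i j => measVersion P (W ℓ i j) :=
  ⟨fun _ _ => measurable_measVersion _ _, fun _ _ _ => measurable_measVersion _ _⟩

variable {P : Measure Ω} {L : ℕ} {w : ℕ → ℕ} {Cb CW : ℝ≥0} {b : ℕ → ℕ → Ω → ℝ}
  {W : ℕ → ℕ → ℕ → Ω → ℝ}

theorem IsGaussianInit.measVersion (h : IsGaussianInit P L w Cb CW b W) :
    IsGaussianInit P L w Cb CW (fun ℓ i => measVersion P (b ℓ i))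
      fun ℓ i j => measVersion P (W ℓ i j) where
  bias ℓ hℓ i hi :=
    (h.bias ℓ hℓ i hi).congr (ae_eq_measVersion (h.bias ℓ hℓ i hi).aemeasurable).symm
  weight ℓ hℓ i hi j hj :=
    (h.weight ℓ hℓ i hi j hj).congr (ae_eq_measVersion (h.weight ℓ hℓ i hi j hj).aemeasurable).symm
  indep := by
    refine h.indep.congr fun i => ?_
    rcases i with ⟨ℓ, i⟩ | ⟨ℓ, i, j⟩
    · exact ae_eq_measVersion (h.bias ℓ (by omega) i i.2).aemeasurable
    · exact ae_eq_measVersion (h.weight ℓ (by omega) i i.2 j j.2).aemeasurable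

theorem networkOutput_ae_eq_measVersion {A : Type*} (σ : ℝ → ℝ) {n₀ m : ℕ} (hw : w 0 = n₀)
    (hout : w (L + 1) = m) (h : IsGaussianInit P L w Cb CW b W) (x : A → Fin n₀ → ℝ) :
    networkOutput σ L m w b W x =ᵐ[P] networkOutput σ L m w (fun ℓ i => measVersion P (b ℓ i))
      (fun ℓ i j => measVersion P (W ℓ i j)) x := by
  have hb : ∀ᵐ ω ∂P, ∀ ℓ i, ℓ ≤ L → i < w (ℓ + 1) →
      b (ℓ + 1) i ω = measVersion P (b (ℓ + 1) i) ω := by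
    refine ae_all_iff.2 fun ℓ => ae_all_iff.2 fun i => ?_
    by_cases hi : ℓ ≤ L ∧ i < w (ℓ + 1)
    · exact (ae_eq_measVersion (h.bias ℓ hi.1 i hi.2).aemeasurable).mono fun ω hω _ _ => hω
    · exact Eventually.of_forall fun ω h1 h2 => absurd ⟨h1, h2⟩ hi
  have hW : ∀ᵐ ω ∂P, ∀ ℓ i j, ℓ ≤ L → i < w (ℓ + 1) → j < w ℓ →
      W (ℓ + 1) i j ω = measVersion P (W (ℓ + 1) i j) ω := by
    refine ae_all_iff.2 fun ℓ => ae_all_iff.2 fun i => ae_all_iff.2 fun j => ?_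
    by_cases hi : ℓ ≤ L ∧ i < w (ℓ + 1) ∧ j < w ℓ
    · exact (ae_eq_measVersion (h.weight ℓ hi.1 i hi.2.1 j hi.2.2).aemeasurable).mono
        fun ω hω _ _ _ => hω
    · exact Eventually.of_forall fun ω h1 h2 h3 => absurd ⟨h1, h2, h3⟩ hi
  filter_upwards [hb, hW] with ω hbω hWω
  ext α k
  exact preactivation_congr σ hw (fun ℓ hℓ i hi => hbω ℓ i hℓ hi)
    (fun ℓ hℓ i hi j hj => hWω ℓ i j hℓ hi hj) (x α) le_rfl (hout ▸ k.2)

theorem measurable_networkOutput {A : Type*} [Fintype A] {σ : ℝ → ℝ} (hσ : Continuous σ)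
    {n₀ m : ℕ} (hw : w 0 = n₀)
    (hout : w (L + 1) = m) (hm : MeasurableParams b W) (x : A → Fin n₀ → ℝ) :
    Measurable (networkOutput σ L m w b W x) := by
  subst hout
  refine measurable_pi_lambda _ fun α => measurable_pi_lambda _ fun h => ?_
  have h1 : (fun ω => networkOutput σ L (w (L + 1)) w b W x ω α h) = fun ω =>
      linComb (paramCoeff (layerAct σ w b W x L ω)) (layerParam w b W L ω h) α :=
    funext fun ω => congrFun (preactivation_eq_linComb σ hw b W x L h ω) α
  rw [h1]
  exact (measurable_pi_apply α).comp (continuous_linComb_paramCoeff.measurable.comp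
    ((hm.layerAct hσ hw x L).prodMk ((measurable_pi_apply h).comp (hm.layerParam L))))

end Measurability

/-- The hidden layer `ℓ'` is, up to a factor `2`, the narrowest one for large `n`, so the speed
`1 / a n` is negligible compared with the width of every hidden layer. -/
theorem tendsto_mul_width {L : ℕ} {w : ℕ → ℕ → ℕ} {ℓ' : ℕ} {γ : ℕ → ℝ≥0∞}
    (hw : WidthCondition L w ℓ' γ) {a : ℕ → ℝ} (ha : ∀ n, 0 < a n)
    (hlim : Tendsto (fun n => a n * (w n ℓ' : ℝ)) atTop atTop) {ℓ : ℕ}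
    (hℓ : ℓ ∈ Finset.Icc 1 L) : Tendsto (fun n => (w n ℓ : ℝ) / (1 / a n)) atTop atTop := by
  have h1 : ∀ᶠ n in atTop, (1 / 2 : ℝ≥0∞) < (w n ℓ : ℝ≥0∞) / (w n ℓ' : ℝ≥0∞) :=
    (hw.ratio ℓ hℓ).eventually_const_lt
      (lt_of_lt_of_le (by simp) (hw.one_le ℓ hℓ))
  refine tendsto_atTop_mono' _ ?_ (hlim.const_mul_atTop (by norm_num : (0 : ℝ) < 1 / 2))
  filter_upwards [h1] with n hn
  have hpos : 0 < w n ℓ' := hw.pos n ℓ' hw.mem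
  have h2 : (w n ℓ' : ℝ) ≤ 2 * w n ℓ := by
    rw [ENNReal.lt_div_iff_mul_lt (by simp [hpos.ne']) (by simp)] at hn
    have h3 : (w n ℓ' : ℝ≥0∞) ≤ 2 * w n ℓ := by
      calc (w n ℓ' : ℝ≥0∞) = 2 * (1 / 2 * w n ℓ') := by
            rw [← mul_assoc, one_div, ENNReal.mul_inv_cancel (by simp) (by simp), one_mul]
        _ ≤ 2 * w n ℓ := by gcongr
    exact_mod_cast h3
  rw [div_div_eq_mul_div, div_one]
  have := mul_le_mul_of_nonneg_left h2 (ha n).le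
  linarith

theorem mainTheorem2
    {A : Type*} [Fintype A] [DecidableEq A]
    (σ : ℝ → ℝ) (hσ_cont : Continuous σ) (hσ_bdd : ∃ M : ℝ, ∀ t, |σ t| ≤ M)
    (L : ℕ) (hL : 1 ≤ L) (n₀ m : ℕ) (hn₀ : 0 < n₀) (hm : 0 < m)
    (Cb CW : ℝ≥0) (hCW : 0 < CW)
    (x : A → Fin n₀ → ℝ)
    -- `w n ℓ` is the width of layer `ℓ` of the `n`-th network, `0 ≤ ℓ ≤ L + 1`
    (w : ℕ → ℕ → ℕ) (hw_in : ∀ n, w n 0 = n₀) (hw_out : ∀ n, w n (L + 1) = m)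
    (ℓ' : ℕ) (γ : ℕ → ℝ≥0∞) (hw : WidthCondition L w ℓ' γ)
    {Ω : ℕ → Type*} [∀ n, MeasurableSpace (Ω n)]
    (P : ∀ n, Measure (Ω n)) [∀ n, IsProbabilityMeasure (P n)]
    (b : ∀ n, ℕ → ℕ → Ω n → ℝ) (W : ∀ n, ℕ → ℕ → ℕ → Ω n → ℝ)
    (hinit : ∀ n, IsGaussianInit (P n) L (w n) Cb CW (b n) (W n))
    (a : ℕ → ℝ) (ha_pos : ∀ n, 0 < a n) (ha_zero : Tendsto a atTop (𝓝 0))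
    (ha_top : Tendsto (fun n => a n * (w n ℓ' : ℝ)) atTop atTop) :
    SatisfiesLDP
        (fun n => (P n).map
          (fun ω => Real.sqrt (a n) • networkOutput σ L m (w n) (b n) (W n) x ω))
        (fun n => 1 / a n)
        (mdRate (m := m) (limitCov σ Cb CW x L)) ∧
      IsGoodRateFunction (mdRate (m := m) (limitCov σ Cb CW x L)) ∧
      (IsUnit (limitCov σ Cb CW x L) →
        IsUnit (matSqrt (limitCov σ Cb CW x L)) ∧
        ∀ z : A → Fin m → ℝ,
          mdRate (limitCov σ Cb CW x L) z =
            ENNReal.ofReal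
              (normSq ((matSqrt (limitCov σ Cb CW x L))⁻¹ * Matrix.of z) / 2)) := by
  obtain ⟨M, hM⟩ := hσ_bdd
  have hg := posSemidef_limitCov hσ_cont hM Cb CW x L
  refine ⟨?_, isGoodRateFunction_mdRate hg, fun hu => ⟨isUnit_matSqrt hg hu, fun z =>
    mdRate_of_isUnit_matSqrt (isUnit_matSqrt hg hu) z⟩⟩
  have hspeed : IsSpeed fun n => 1 / a n := by
    refine ⟨fun n => one_div_pos.2 (ha_pos n), ?_⟩
    simp only [one_div]
    exact (tendsto_nhdsWithin_iff.2 ⟨ha_zero, Eventually.of_forall ha_pos⟩).inv_tendsto_nhdsGT_zero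
  have hmeas : ∀ n, Measurable (networkOutput σ L m (w n)
      (fun ℓ i => measVersion (P n) (b n ℓ i)) (fun ℓ i j => measVersion (P n) (W n ℓ i j)) x) :=
    fun n => measurable_networkOutput hσ_cont (hw_in n) (hw_out n)
      (measurableParams_measVersion _ _ _) x
  have hmap : ∀ n, (P n).map
      (fun ω => Real.sqrt (a n) • networkOutput σ L m (w n) (b n) (W n) x ω) =
      (P n).map fun ω => Real.sqrt (a n) • networkOutput σ L m (w n)
        (fun ℓ i => measVersion (P n) (b n ℓ i))
        (fun ℓ i j => measVersion (P n) (W n ℓ i j)) x ω := fun n =>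
    Measure.map_congr ((networkOutput_ae_eq_measVersion σ (hw_in n) (hw_out n) (hinit n) x).mono
      fun ω hω => congrArg (Real.sqrt (a n) • ·) hω)
  simp_rw [hmap]
  refine satisfiesLDP_of_hasLaplaceLimit hg (fun n => ?_) hspeed ?_
  · exact Measure.isProbabilityMeasure_map ((hmeas n).const_smul (Real.sqrt (a n))).aemeasurable
  · exact hasLaplaceLimit_networkOutput hσ_cont hM hL hCW x hw_in hw_out hw.pos
      (fun n => measurableParams_measVersion _ _ _) (fun n => (hinit n).measVersion) ha_pos hspeed
      (fun ℓ hℓ => tendsto_mul_width hw ha_pos ha_top hℓ) fun n => (hmeas n).aemeasurable
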